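/- Write $\vdash_T$ for derivability from a theory $T$ in classical first-order logic with equality; $T$ is consistent if $\not\vdash_T\bot$. Axioms with free variables stand for their universal closures, and $\Phi$ below ranges over all formulas of the respective language, with parameters allowed. **ZF** is Zermelo–Fraenkel set theory in the language with $\in$, $=$ and a constant $\emptyset$; all variables range over sets. Its axioms are extensionality, empty set ($\exists x(x=\emptyset\wedge\forall y\; y\notin x)$), the separation schema, pairing, union, power set, infinity ($\exists x(\emptyset\in x\wedge\forall y(y\in x\Rightarrow\{y\}\in x))$), the replacement schema, and regularity. **Set Matrix Theory (SMT)** has Roman variables $x,y,u,z,\dots$ ranging over sets and Greek variables $\alpha,\beta,\gamma,\delta,\zeta,\dots$ ranging over set matrices, every set being a set matrix. Its language has $\in$, $=$, the constant $\emptyset$ (a set), and for all positive integers $m,n$ an $mn$-ary function symbol $f_{m\times n}$, whose arguments may be arbitrary terms and whose values are set matrices; $[t_{ij}]_{m\times n}$ denotes $f_{m\times n}(t_{11},\dots,t_{mn})$ and $[t]$ denotes $f_{1\times 1}(t)$. For all positive integers $m,n,p,q$ it has the following axioms. Matrix axioms: 1. Set matrices: $\forall\alpha_{11}\cdots\forall\alpha_{mn}\exists\beta:\beta=[\alpha_{ij}]_{m\times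 n}$. 2. Reduction: $\forall x:[x]=x$. 3. Omission: $\forall\alpha_{11}\cdots\forall\alpha_{mn}:[[\alpha_{ij}]_{m\times n}]=[\alpha_{ij}]_{m\times n}$. 4. Division: $\forall x\forall\alpha_{11}\cdots\forall\alpha_{mn}:x\ne[\alpha_{ij}]_{m\times n}$ if $mn\ge2$; and $\forall\alpha_{11}\cdots\forall\alpha_{mn}\forall\beta_{11}\cdots\forall\beta_{pq}:[\alpha_{ij}]_{m\times n}\neq[\beta_{ij}]_{p\times q}$ if $(1,1)\ne(m,n)\ne(p,q)\ne(1,1)$. 5. Epsilon: $\forall\alpha_{11}\cdots\forall\alpha_{mn}\forall\beta:\beta\notin[\alpha_{ij}]_{m\times n}$ if $mn\ge2$. 6. Extensionality for matrices: $\forall\alpha_{11}\cdots\forall\alpha_{mn}\forall\beta_{11}\cdots\forall\beta_{mn}:[\alpha_{ij}]_{m\times n}=[\beta_{ij}]_{m\times n}\Leftrightarrow\alpha_{11}=\beta_{11}\wedge\dots\wedge\alpha_{mn}=\beta_{mn}$. Set axioms: 7. Extensionality: $\forall x\forall y: x=y\Leftrightarrow\forall\alpha(\alpha\in x\Leftrightarrow\alpha\in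 y)$. 8. Empty set: $\exists x: x=\emptyset\wedge\forall\alpha(\alpha\notin x)$. 9. Separation: $\forall x\exists y\forall\alpha:\alpha\in y\Leftrightarrow\alpha\in x\wedge\Phi(\alpha)$. 10. Pairing: $\forall\alpha\forall\beta\exists x\forall\gamma:\gamma\in x\Leftrightarrow\gamma=\alpha\vee\gamma=\beta$. 11. Union: $\forall x:\forall\alpha(\alpha\in x\Rightarrow\exists u(u=\alpha))\Rightarrow\exists y\forall\beta(\beta\in y\Leftrightarrow\exists z(z\in x\wedge\beta\in z))$. 12. Power set: $\forall x\exists y\forall\alpha:\alpha\in y\Leftrightarrow\exists u(u=\alpha\wedge\forall\beta(\beta\in u\Rightarrow\beta\in x))$. 13. Infinity: $\exists x:\emptyset\in x\wedge\forall y(y\in x\Rightarrow\{y\}\in x)$, where $\{y\}\in x$ abbreviates $\exists z(z\in x\wedge\forall\alpha(\alpha\in z\Leftrightarrow\alpha=y))$. 14. Replacement: $\forall x:\forall\alpha(\alpha\in x\Rightarrow\exists!\beta\,\Phi(\alpha,\beta))\Rightarrow\exists y\forall\zeta(\zeta\in y\Leftrightarrow\exists\gamma(\gamma\in x\wedge\Phi(\gamma,\zeta)))$.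 15. Sets of set matrices: $\forall x\exists y\forall\alpha:\alpha\in y\Leftrightarrow\exists\beta_{11}\cdots\exists\beta_{mn}(\alpha=[\beta_{ij}]_{m\times n}\wedge\beta_{11}\in x\wedge\dots\wedge\beta_{mn}\in x)$. 16. Regularity: $\forall x: x\neq\emptyset\Rightarrow\exists\alpha(\alpha\in x\wedge\neg\exists\beta(\beta\in\alpha\wedge\beta\in x))$. **Proposition.** SMT is consistent relative to ZF: if $\not\vdash_{\mathrm{ZF}}\bot$, then $\not\vdash_{\mathrm{SMT}}\bot$. -/

import Mathlib

namespace SetMatrixTheory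

/-! ### First-order logic with ordered sorts -/

/-- A first-order signature whose variables come in several sorts.  The sorts are ordered by
inclusion of their ranges (`k ≤ l`: whatever a variable of sort `k` ranges over is also in the range
of the variables of sort `l`).  Every function symbol has a sort for its values; arguments of
function and relation symbols may be arbitrary terms. -/
structure SortedLanguage where
  /-- the function and relation symbols -/
  symbols : FirstOrder.Language.{0, 0}
  /-- the sorts of variables -/
  Srt : Type
  [order : PartialOrder Srt]
  [decEq : DecidableEq Srt]
  /-- the sort of the values of a function symbol -/
  valueSort : ∀ {n : ℕ}, symbols.Functions n → Srt

attribute [instance] SortedLanguage.order SortedLanguage.decEq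

/-- `(k, i)` is the variable of sort `k` with label `i`. -/
abbrev SortedLanguage.Var (S : SortedLanguage) : Type := S.Srt × ℕ

abbrev SortedLanguage.Term (S : SortedLanguage) : Type := S.symbols.Term S.Var

/-- The sort of a term. -/
def sortOf {S : SortedLanguage} : S.Term → S.Srt
  | .var v => v.1
  | .func f _ => S.valueSort f

/-- First-order formulas, with equality.  Bound variables are de Bruijn indices, counted for each
sort separately: in `all k φ` the quantifier binds the variable `(k, 0)` of `φ`, the variable
`(k, i + 1)` of `φ` is the variable `(k, i)` of `all k φ`, and the variables of the other sorts keep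
their labels. -/
inductive Formula (S : SortedLanguage) : Type
  | falsum : Formula S
  | equal (t u : S.Term) : Formula S
  | rel {n : ℕ} (R : S.symbols.Relations n) (ts : Fin n → S.Term) : Formula S
  | imp (φ ψ : Formula S) : Formula S
  | all (k : S.Srt) (φ : Formula S) : Formula S

namespace Formula

variable {S : SortedLanguage}

def neg (φ : Formula S) : Formula S := imp φ falsum

def and (φ ψ : Formula S) : Formula S := neg (imp φ (neg ψ))

def or (φ ψ : Formula S) : Formula S := imp (neg φ) ψ

def iff (φ ψ : Formula S) : Formula S := and (imp φ ψ) (imp ψ φ)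

def ex (k : S.Srt) (φ : Formula S) : Formula S := neg (all k (neg φ))

/-- A block of `N` universal quantifiers of sort `k`, binding `(k, 0), …, (k, N - 1)`. -/
def allBlock (k : S.Srt) : ℕ → Formula S → Formula S
  | 0, φ => φ
  | N + 1, φ => allBlock k N (all k φ)

/-- A block of `N` existential quantifiers of sort `k`, binding `(k, 0), …, (k, N - 1)`. -/
def exBlock (k : S.Srt) : ℕ → Formula S → Formula S
  | 0, φ => φ
  | N + 1, φ => exBlock k N (ex k φ)

/-- Finite conjunction. -/
def conj : List (Formula S) → Formula S
  | [] => neg falsum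
  | [φ] => φ
  | φ :: ψ :: l => and φ (conj (ψ :: l))

end Formula

section Substitution

variable {S : SortedLanguage}

/-- The new label of a free variable after passing under a quantifier of sort `k`. -/
def shift (k : S.Srt) (v : S.Var) : S.Var := if v.1 = k then (v.1, v.2 + 1) else v

/-- A simultaneous substitution, passed under a quantifier of sort `k`. -/
def up (k : S.Srt) (σ : S.Var → S.Term) : S.Var → S.Term
  | (l, 0) => if l = k then .var (l, 0) else (σ (l, 0)).relabel (shift k)
  | (l, i + 1) => if l = k then (σ (l, i)).relabel (shift k) else (σ (l, i + 1)).relabel (shift k)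

/-- Simultaneous (capture-avoiding) substitution of terms for free variables. -/
def Formula.subst : Formula S → (S.Var → S.Term) → Formula S
  | .falsum, _ => .falsum
  | .equal t u, σ => .equal (t.subst σ) (u.subst σ)
  | .rel R ts, σ => .rel R (fun i => (ts i).subst σ)
  | .imp φ ψ, σ => .imp (φ.subst σ) (ψ.subst σ)
  | .all k φ, σ => .all k (φ.subst (up k σ))

/-- Renaming of free variables. -/
def Formula.rename (φ : Formula S) (ρ : S.Var → S.Var) : Formula S := φ.subst (fun v => .var (ρ v))

/-- `φ`, read in the scope of one more quantifier of sort `k` whose variable does not occur. -/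
def Formula.lift (k : S.Srt) (φ : Formula S) : Formula S := φ.rename (shift k)

/-- The substitution that strips a quantifier of sort `k`, its variable being replaced by `t`. -/
def instSubst (k : S.Srt) (t : S.Term) : S.Var → S.Term
  | (l, 0) => if l = k then t else .var (l, 0)
  | (l, i + 1) => if l = k then .var (l, i) else .var (l, i + 1)

/-- `φ[t]`: the term `t` replaces the variable `(k, 0)` of `φ`. -/
def Formula.inst (k : S.Srt) (φ : Formula S) (t : S.Term) : Formula S := φ.subst (instSubst k t)

end Substitution

/-- Derivability `T ⊢ φ` in classical first-order logic with equality (a Hilbert calculus with modus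
ponens and generalization).  Only terms whose sort is included in `k` may be put for a variable of
sort `k`.  Because of the generalization rule, a non-logical axiom with free variables
amounts to its universal closure. -/
inductive Provable {S : SortedLanguage} (T : Set (Formula S)) : Formula S → Prop
  | ax {φ : Formula S} : φ ∈ T → Provable T φ
  | mp {φ ψ : Formula S} : Provable T (.imp φ ψ) → Provable T φ → Provable T ψ
  | gen (k : S.Srt) {φ : Formula S} : Provable T φ → Provable T (.all k φ)
  | imp_weaken (φ ψ : Formula S) : Provable T (.imp φ (.imp ψ φ))
  | imp_distrib (φ ψ χ : Formula S) :
      Provable T (.imp (.imp φ (.imp ψ χ)) (.imp (.imp φ ψ) (.imp φ χ)))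
  | neg_neg (φ : Formula S) : Provable T (.imp φ.neg.neg φ)
  | all_inst (k : S.Srt) (φ : Formula S) (t : S.Term) (ht : sortOf t ≤ k) :
      Provable T (.imp (.all k φ) (φ.inst k t))
  | all_imp (k : S.Srt) (φ ψ : Formula S) :
      Provable T (.imp (.all k (.imp (φ.lift k) ψ)) (.imp φ (.all k ψ)))
  | eq_refl (t : S.Term) : Provable T (.equal t t)
  | eq_subst (k : S.Srt) (φ : Formula S) (t u : S.Term) (ht : sortOf t ≤ k) (hu : sortOf u ≤ k) :
      Provable T (.imp (.equal t u) (.imp (φ.inst k t) (φ.inst k u)))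

/-- `T` is consistent: `T ⊬ ⊥`. -/
def Consistent {S : SortedLanguage} (T : Set (Formula S)) : Prop := ¬ Provable T .falsum

/-- The only relation symbol besides equality: the binary `∈`. -/
inductive MemSymbol : ℕ → Type
  | mem : MemSymbol 2

local infix:70 " ≐ " => Formula.equal
local prefix:75 "∼" => Formula.neg
local infixr:65 " ⩓ " => Formula.and
local infixr:64 " ⩔ " => Formula.or
local infixr:62 " ⟹ " => Formula.imp
local infix:61 " ⟺ " => Formula.iff

/-! ### The theory ZF -/

namespace ZF

/-- The only function symbol: the constant `∅`. -/
inductive FunSymbol : ℕ → Type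
  | empty : FunSymbol 0

/-- The one-sorted language of ZF, with `∈`, `=` and the constant `∅`. -/
def lang : SortedLanguage where
  symbols := ⟨FunSymbol, MemSymbol⟩
  Srt := Unit
  order := inferInstance
  decEq := inferInstance
  valueSort := fun _ => ()

/-- The variable with label `i`. -/
def x (i : ℕ) : lang.Term := .var ((), i)

/-- The term `∅`. -/
def empt : lang.Term := .func FunSymbol.empty Fin.elim0

def mem (t u : lang.Term) : Formula lang :=
  Formula.rel (S := lang) MemSymbol.mem ![t, u]

def all (φ : Formula lang) : Formula lang := Formula.all (S := lang) () φ

def ex (φ : Formula lang) : Formula lang := Formula.ex (S := lang) () φ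

/-- Renaming of the variables of a formula along a map of labels. -/
def relabel (φ : Formula lang) (ρ : ℕ → ℕ) : Formula lang := φ.rename (fun v => ((), ρ v.2))

local infix:70 " ε " => mem

/-- `∀ x ∀ y (x = y ↔ ∀ z (z ∈ x ↔ z ∈ y))` -/
def extensionality : Formula lang :=
  all (all (x 1 ≐ x 0 ⟺ all (x 0 ε x 2 ⟺ x 0 ε x 1)))

/-- `∃ x (x = ∅ ∧ ∀ y, y ∉ x)` -/
def emptySet : Formula lang :=
  ex (x 0 ≐ empt ⩓ all (∼(x 0 ε x 1)))

/-- `∀ x ∃ y ∀ z (z ∈ y ↔ z ∈ x ∧ Φ(z))`.  In `Φ` the labels are: 0 for `z`, 1 for `x`, and 2, 3, …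
for parameters. -/
def separation (Φ : Formula lang) : Formula lang :=
  all (ex (all (x 0 ε x 1 ⟺ x 0 ε x 2 ⩓ relabel Φ (fun | 0 => 0 | i + 1 => i + 2))))

/-- `∀ x ∀ y ∃ z ∀ w (w ∈ z ↔ w = x ∨ w = y)` -/
def pairing : Formula lang :=
  all (all (ex (all (x 0 ε x 1 ⟺ x 0 ≐ x 3 ⩔ x 0 ≐ x 2))))

/-- `∀ x ∃ y ∀ z (z ∈ y ↔ ∃ u (u ∈ x ∧ z ∈ u))` -/
def union : Formula lang :=
  all (ex (all (x 0 ε x 1 ⟺ ex (x 0 ε x 3 ⩓ x 1 ε x 0))))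

/-- `∀ x ∃ y ∀ u (u ∈ y ↔ ∀ z (z ∈ u → z ∈ x))` -/
def powerSet : Formula lang :=
  all (ex (all (x 0 ε x 1 ⟺ all (x 0 ε x 1 ⟹ x 0 ε x 3))))

/-- `∃ x (∅ ∈ x ∧ ∀ y (y ∈ x → {y} ∈ x))`, where `{y} ∈ x` is `∃ z (z ∈ x ∧ ∀ w (w ∈ z ↔ w = y))`. -/
def infinity : Formula lang :=
  ex (empt ε x 0 ⩓ all (x 0 ε x 1 ⟹ ex (x 0 ε x 2 ⩓ all (x 0 ε x 1 ⟺ x 0 ≐ x 2))))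

/-- `∀ x (∀ u (u ∈ x → ∃! v Φ(u, v)) → ∃ y ∀ v (v ∈ y ↔ ∃ u (u ∈ x ∧ Φ(u, v))))`, where `∃! v Φ(u, v)`
is `∃ v ∀ w (Φ(u, w) ↔ w = v)`.  In `Φ` the labels are: 0 for the value `v`, 1 for the argument `u`,
2 for `x`, and 3, 4, … for parameters. -/
def replacement (Φ : Formula lang) : Formula lang :=
  all (all (x 0 ε x 1 ⟹
        ex (all (relabel Φ (fun | 0 => 0 | i + 1 => i + 2) ⟺ x 0 ≐ x 1))) ⟹
      ex (all (x 0 ε x 1 ⟺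
        ex (x 0 ε x 3 ⩓ relabel Φ (fun | 0 => 1 | 1 => 0 | i + 2 => i + 3)))))

/-- `∀ x (x ≠ ∅ → ∃ y (y ∈ x ∧ ¬ ∃ z (z ∈ y ∧ z ∈ x)))` -/
def regularity : Formula lang :=
  all (∼(x 0 ≐ empt) ⟹ ex (x 0 ε x 1 ⩓ ∼(ex (x 0 ε x 1 ⩓ x 0 ε x 2))))

inductive IsAxiom : Formula lang → Prop
  | extensionality : IsAxiom extensionality
  | emptySet : IsAxiom emptySet
  | separation (Φ : Formula lang) : IsAxiom (separation Φ)
  | pairing : IsAxiom pairing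
  | union : IsAxiom union
  | powerSet : IsAxiom powerSet
  | infinity : IsAxiom infinity
  | replacement (Φ : Formula lang) : IsAxiom (replacement Φ)
  | regularity : IsAxiom regularity

/-- Zermelo–Fraenkel set theory. -/
def theory : Set (Formula lang) := {φ | IsAxiom φ}

end ZF

/-! ### Set Matrix Theory -/

namespace SMT

/-- The two sorts of variables: Roman variables range over sets, Greek variables over set
matrices. -/
inductive Kind : Type
  | set : Kind
  | matrix : Kind
  deriving DecidableEq

/-- Every set is a set matrix. -/
instance : PartialOrder Kind where
  le k l := k = .set ∨ l = .matrix
  le_refl k := by cases k <;> simp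
  le_trans k l p := by cases k <;> cases l <;> cases p <;> simp
  le_antisymm k l := by cases k <;> cases l <;> simp

/-- The function symbols: the constant `∅`, and for positive `m`, `n` the `mn`-ary symbol
`f_{m × n}`. -/
inductive FunSymbol : ℕ → Type
  | empty : FunSymbol 0
  | mat (m n : ℕ+) : FunSymbol ((m : ℕ) * (n : ℕ))

def FunSymbol.valueKind {k : ℕ} : FunSymbol k → Kind
  | .empty => .set
  | .mat _ _ => .matrix

/-- The two-sorted language of SMT, with `∈`, `=`, the constant `∅` and the symbols `f_{m × n}`. -/
def lang : SortedLanguage where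
  symbols := ⟨FunSymbol, MemSymbol⟩
  Srt := Kind
  order := inferInstance
  decEq := inferInstance
  valueSort := FunSymbol.valueKind

/-- The Roman variable with label `i`. -/
def x (i : ℕ) : lang.Term := .var (Kind.set, i)

/-- The Greek variable with label `i`. -/
def a (i : ℕ) : lang.Term := .var (Kind.matrix, i)

/-- The term `∅`. -/
def empt : lang.Term := .func FunSymbol.empty Fin.elim0

/-- The term `[t₁₁ ⋯ t₁ₙ; ⋯ ; tₘ₁ ⋯ tₘₙ]`, that is, `f_{m × n}(t₁₁, …, tₘₙ)`. -/
def mat {m n : ℕ+} (t : Matrix (Fin m) (Fin n) lang.Term) : lang.Term :=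
  .func (FunSymbol.mat m n)
    (fun r => t (finProdFinEquiv.symm r).1 (finProdFinEquiv.symm r).2)

/-- The `1 × 1` matrix term `[t]`. -/
def single (t : lang.Term) : lang.Term := mat (m := 1) (n := 1) (fun _ _ => t)

/-- An `m × n` array of distinct Greek variables, with the labels `c, …, c + mn - 1`. -/
def vars (m n : ℕ+) (c : ℕ) : Matrix (Fin m) (Fin n) lang.Term :=
  fun i j => a (c + (finProdFinEquiv (i, j) : Fin ((m : ℕ) * (n : ℕ))))

def mem (t u : lang.Term) : Formula lang :=
  Formula.rel (S := lang) MemSymbol.mem ![t, u]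

/-- Quantifiers over sets. -/
def allSet (φ : Formula lang) : Formula lang := Formula.all (S := lang) Kind.set φ

def exSet (φ : Formula lang) : Formula lang := Formula.ex (S := lang) Kind.set φ

/-- Quantifiers over set matrices. -/
def allMat (φ : Formula lang) : Formula lang := Formula.all (S := lang) Kind.matrix φ

def exMat (φ : Formula lang) : Formula lang := Formula.ex (S := lang) Kind.matrix φ

/-- Blocks of quantifiers over set matrices. -/
def allMats (N : ℕ) (φ : Formula lang) : Formula lang :=
  Formula.allBlock (S := lang) Kind.matrix N φ

def exMats (N : ℕ) (φ : Formula lang) : Formula lang :=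
  Formula.exBlock (S := lang) Kind.matrix N φ

/-- Conjunction of the formulas `φ i j` over the positions `(i, j)` of an `m × n` matrix. -/
def conjEntries {m n : ℕ+} (φ : Fin m → Fin n → Formula lang) : Formula lang :=
  Formula.conj (List.ofFn fun r : Fin ((m : ℕ) * (n : ℕ)) =>
    φ (finProdFinEquiv.symm r).1 (finProdFinEquiv.symm r).2)

/-- Renaming of the Roman variables along `ρ` and of the Greek variables along `τ`. -/
def relabel (φ : Formula lang) (ρ τ : ℕ → ℕ) : Formula lang :=
  φ.rename (fun
    | (Kind.set, i) => (Kind.set, ρ i)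
    | (Kind.matrix, i) => (Kind.matrix, τ i))

local infix:70 " ε " => mem

/-! Matrix-theoretical axioms -/

/-- `∀ α₁₁ ⋯ ∀ αₘₙ ∃ β : β = [αᵢⱼ]` -/
def setMatrix (m n : ℕ+) : Formula lang :=
  allMats (m * n) (exMat (a 0 ≐ mat (vars m n 1)))

/-- `∀ x : [x] = x` -/
def reduction : Formula lang := allSet (single (x 0) ≐ x 0)

/-- `∀ α₁₁ ⋯ ∀ αₘₙ : [[αᵢⱼ]] = [αᵢⱼ]` -/
def omission (m n : ℕ+) : Formula lang :=
  allMats (m * n) (single (mat (vars m n 0)) ≐ mat (vars m n 0))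

/-- `∀ x ∀ α₁₁ ⋯ ∀ αₘₙ : x ≠ [αᵢⱼ]` -/
def divisionSet (m n : ℕ+) : Formula lang :=
  allSet (allMats (m * n) (∼(x 0 ≐ mat (vars m n 0))))

/-- `∀ α₁₁ ⋯ ∀ αₘₙ ∀ β₁₁ ⋯ ∀ β_{pq} : [αᵢⱼ] ≠ [βᵢⱼ]` -/
def divisionMatrix (m n p q : ℕ+) : Formula lang :=
  allMats (m * n) (allMats (p * q) (∼(mat (vars m n (p * q)) ≐ mat (vars p q 0))))

/-- `∀ α₁₁ ⋯ ∀ αₘₙ ∀ β : β ∉ [αᵢⱼ]` -/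
def epsilon (m n : ℕ+) : Formula lang :=
  allMats (m * n) (allMat (∼(a 0 ε mat (vars m n 1))))

/-- `∀ α₁₁ ⋯ ∀ αₘₙ ∀ β₁₁ ⋯ ∀ βₘₙ : [αᵢⱼ] = [βᵢⱼ] ↔ α₁₁ = β₁₁ ∧ ⋯ ∧ αₘₙ = βₘₙ` -/
def matrixExtensionality (m n : ℕ+) : Formula lang :=
  allMats (m * n) (allMats (m * n)
    (mat (vars m n (m * n)) ≐ mat (vars m n 0) ⟺
      conjEntries (fun i j => vars m n (m * n) i j ≐ vars m n 0 i j)))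

/-! Set-theoretical axioms -/

/-- `∀ x ∀ y : x = y ↔ ∀ α (α ∈ x ↔ α ∈ y)` -/
def extensionality : Formula lang :=
  allSet (allSet (x 1 ≐ x 0 ⟺ allMat (a 0 ε x 1 ⟺ a 0 ε x 0)))

/-- `∃ x : x = ∅ ∧ ∀ α (α ∉ x)` -/
def emptySet : Formula lang :=
  exSet (x 0 ≐ empt ⩓ allMat (∼(a 0 ε x 0)))

/-- `∀ x ∃ y ∀ α : α ∈ y ↔ α ∈ x ∧ Φ(α)`.  In `Φ` the Greek label 0 is for `α` and the Roman label 0 is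
for `x`; all other labels are for parameters. -/
def separation (Φ : Formula lang) : Formula lang :=
  allSet (exSet (allMat (a 0 ε x 0 ⟺ a 0 ε x 1 ⩓ relabel Φ (fun i => i + 1) id)))

/-- `∀ α ∀ β ∃ x ∀ γ : γ ∈ x ↔ γ = α ∨ γ = β` -/
def pairing : Formula lang :=
  allMat (allMat (exSet (allMat (a 0 ε x 0 ⟺ a 0 ≐ a 2 ⩔ a 0 ≐ a 1))))

/-- `∀ x : ∀ α (α ∈ x → ∃ u (u = α)) → ∃ y ∀ β (β ∈ y ↔ ∃ z (z ∈ x ∧ β ∈ z))` -/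
def union : Formula lang :=
  allSet (allMat (a 0 ε x 0 ⟹ exSet (x 0 ≐ a 0)) ⟹
    exSet (allMat (a 0 ε x 0 ⟺ exSet (x 0 ε x 2 ⩓ a 0 ε x 0))))

/-- `∀ x ∃ y ∀ α : α ∈ y ↔ ∃ u (u = α ∧ u ⊆ x)`, where `u ⊆ x` is `∀ β (β ∈ u → β ∈ x)`. -/
def powerSet : Formula lang :=
  allSet (exSet (allMat (a 0 ε x 0 ⟺
    exSet (x 0 ≐ a 0 ⩓ allMat (a 0 ε x 0 ⟹ a 0 ε x 2)))))

/-- `∃ x : ∅ ∈ x ∧ ∀ y (y ∈ x → {y} ∈ x)`, where `{y} ∈ x` is `∃ z (z ∈ x ∧ ∀ α (α ∈ z ↔ α = y))`. -/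
def infinity : Formula lang :=
  exSet (empt ε x 0 ⩓ allSet (x 0 ε x 1 ⟹ exSet (x 0 ε x 2 ⩓ allMat (a 0 ε x 0 ⟺ a 0 ≐ x 1))))

/-- `∀ x : ∀ α (α ∈ x → ∃! β Φ(α, β)) → ∃ y ∀ ζ (ζ ∈ y ↔ ∃ γ (γ ∈ x ∧ Φ(γ, ζ)))`, where `∃! β Φ(α, β)` is
`∃ β ∀ δ (Φ(α, δ) ↔ δ = β)`.  In `Φ` the Greek label 0 is for the value, the Greek label 1 for the
argument and the Roman label 0 for `x`; all other labels are for parameters. -/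
def replacement (Φ : Formula lang) : Formula lang :=
  allSet (allMat (a 0 ε x 0 ⟹
        exMat (allMat (relabel Φ id (fun | 0 => 0 | i + 1 => i + 2) ⟺ a 0 ≐ a 1))) ⟹
      exSet (allMat (a 0 ε x 0 ⟺
        exMat (a 0 ε x 1 ⩓
          relabel Φ (fun i => i + 1) (fun | 0 => 1 | 1 => 0 | i + 2 => i + 2)))))

/-- `∀ x ∃ y ∀ α : α ∈ y ↔ ∃ β₁₁ ⋯ ∃ βₘₙ (α = [βᵢⱼ] ∧ β₁₁ ∈ x ∧ ⋯ ∧ βₘₙ ∈ x)` -/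
def setOfSetMatrices (m n : ℕ+) : Formula lang :=
  allSet (exSet (allMat (a 0 ε x 0 ⟺
    exMats (m * n) (a (m * n) ≐ mat (vars m n 0) ⩓
      conjEntries (fun i j => vars m n 0 i j ε x 1)))))

/-- `∀ x : x ≠ ∅ → ∃ α (α ∈ x ∧ ¬ ∃ β (β ∈ α ∧ β ∈ x))` -/
def regularity : Formula lang :=
  allSet (∼(x 0 ≐ empt) ⟹ exMat (a 0 ε x 0 ⩓ ∼(exMat (a 0 ε a 1 ⩓ a 0 ε x 0))))

inductive IsAxiom : Formula lang → Prop
  | setMatrix (m n : ℕ+) : IsAxiom (setMatrix m n)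
  | reduction : IsAxiom reduction
  | omission (m n : ℕ+) : IsAxiom (omission m n)
  | divisionSet (m n : ℕ+) (h : 2 ≤ m * n) : IsAxiom (divisionSet m n)
  | divisionMatrix (m n p q : ℕ+) (h₁ : (1, 1) ≠ (m, n)) (h₂ : (m, n) ≠ (p, q))
      (h₃ : (p, q) ≠ (1, 1)) : IsAxiom (divisionMatrix m n p q)
  | epsilon (m n : ℕ+) (h : 2 ≤ m * n) : IsAxiom (epsilon m n)
  | matrixExtensionality (m n : ℕ+) : IsAxiom (matrixExtensionality m n)
  | extensionality : IsAxiom extensionality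
  | emptySet : IsAxiom emptySet
  | separation (Φ : Formula lang) : IsAxiom (separation Φ)
  | pairing : IsAxiom pairing
  | union : IsAxiom union
  | powerSet : IsAxiom powerSet
  | infinity : IsAxiom infinity
  | replacement (Φ : Formula lang) : IsAxiom (replacement Φ)
  | setOfSetMatrices (m n : ℕ+) : IsAxiom (setOfSetMatrices m n)
  | regularity : IsAxiom regularity

/-- Set Matrix Theory. -/
def theory : Set (Formula lang) := {φ | IsAxiom φ}

end SMT

end SetMatrixTheory

/-!
# Consistency of Set Matrix Theory relative to ZF

If ZF is consistent, it has a model `U` by the completeness theorem (`ZF.exists_model`).  From `U` a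
model of SMT is built on the same carrier (`SMT.interp`), and the soundness of the calculus
(`consistent_of_model`) yields the consistency of SMT.

*Completeness.*  The free variables of the language serve as Henkin witnesses, so that the language
need not be extended.  The irrefutable formulas, ordered by provable implication, are the conditions
of a forcing argument: deciding a formula, and implying `∀ ψ` or refuting an instance of `ψ`, are
dense requirements, the latter because a fresh variable is always available and theorems are closed
under renaming of free variables.  There are countably many such requirements, and the
Rasiowa–Sikorski lemma gives a complete Henkin set.  Its term model is the model sought.

*The model of SMT.*  All elements of `U` are set matrices.  A set with the members of `a` is
represented by `code a`, which is `a` if `a` has at most one member and `a ∪ {a}` otherwise.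
By regularity `code` is injective, and no two-element set is in its range.  So the two-element sets
are free to be matrices: for `mn ≥ 2` the matrix `[tᵢⱼ]` is `{∅, {w}}`, where `w` is a tuple of `m`,
`n` and the entries, while `1 × 1` matrices are identified with their entries.  Two properties of
`code` make the axioms easy to verify: it fixes `∅` and all singletons, so that a set witnessing the
axiom of infinity in `U` still does so in the new model, and `a ⊆ code a`, so that membership in the
sense of SMT implies membership in `U` and regularity is inherited.  The schemata hold since
satisfaction in the new model is definable in `U`, formula by formula (`SMT.def_sat`).
-/

namespace SetMatrixTheory

/-! ### Semantics and soundness -/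

/-- An interpretation of a sorted language: a structure for its symbols on `carrier`, together with
the range `dom k` of the variables of each sort `k`.  The function symbols are total on `carrier`,
so that terms have values under every assignment. -/
structure Interp (S : SortedLanguage) where
  carrier : Type
  [str : S.symbols.Structure carrier]
  dom : S.Srt → Set carrier
  dom_mono : ∀ {k l : S.Srt}, k ≤ l → dom k ⊆ dom l
  funMap_mem : ∀ {n : ℕ} (f : S.symbols.Functions n) (xs : Fin n → carrier),
    FirstOrder.Language.Structure.funMap f xs ∈ dom (S.valueSort f)

attribute [instance] Interp.str

variable {S : SortedLanguage}

/-- The assignment `v` passed under a quantifier of sort `k` whose variable takes the value `b`. -/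
def push {M : Type} (k : S.Srt) (b : M) (v : S.Var → M) : S.Var → M
  | (l, 0) => if l = k then b else v (l, 0)
  | (l, i + 1) => if l = k then v (l, i) else v (l, i + 1)

/-- The value of a term under an assignment. -/
def Interp.eval (I : Interp S) (v : S.Var → I.carrier) (t : S.Term) : I.carrier := t.realize v

/-- Satisfaction of a formula under an assignment, with the quantifiers of sort `k` ranging over
`dom k`. -/
def Sat (I : Interp S) : Formula S → (S.Var → I.carrier) → Prop
  | .falsum, _ => False
  | .equal t u, v => I.eval v t = I.eval v u
  | .rel R ts, v => FirstOrder.Language.Structure.RelMap R (fun i => I.eval v (ts i))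
  | .imp φ ψ, v => Sat I φ v → Sat I ψ v
  | .all k φ, v => ∀ b ∈ I.dom k, Sat I φ (push k b v)

section Connectives

variable (I : Interp S) (φ ψ : Formula S) (v : S.Var → I.carrier)

@[simp] lemma sat_falsum : ¬ Sat I .falsum v := id

@[simp] lemma sat_equal (t u : S.Term) :
    Sat I (.equal t u) v ↔ I.eval v t = I.eval v u := Iff.rfl

@[simp] lemma sat_imp : Sat I (.imp φ ψ) v ↔ (Sat I φ v → Sat I ψ v) := Iff.rfl

@[simp] lemma sat_all (k : S.Srt) :
    Sat I (.all k φ) v ↔ ∀ b ∈ I.dom k, Sat I φ (push k b v) := Iff.rfl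

@[simp] lemma sat_neg : Sat I φ.neg v ↔ ¬ Sat I φ v := Iff.rfl

@[simp] lemma sat_and : Sat I (φ.and ψ) v ↔ Sat I φ v ∧ Sat I ψ v := by
  simp [Formula.and]

@[simp] lemma sat_or : Sat I (φ.or ψ) v ↔ Sat I φ v ∨ Sat I ψ v := by
  simp only [Formula.or, sat_imp, sat_neg]; tauto

@[simp] lemma sat_iff : Sat I (φ.iff ψ) v ↔ (Sat I φ v ↔ Sat I ψ v) := by
  simp only [Formula.iff, sat_and, sat_imp]; tauto

@[simp] lemma sat_ex (k : S.Srt) :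
    Sat I (.ex k φ) v ↔ ∃ b ∈ I.dom k, Sat I φ (push k b v) := by
  simp [Formula.ex]

lemma sat_conj (l : List (Formula S)) : Sat I (.conj l) v ↔ ∀ φ ∈ l, Sat I φ v := by
  induction l with
  | nil => simp [Formula.conj]
  | cons φ l ih => cases l with
    | nil => simp [Formula.conj]
    | cons ψ l => simp only [Formula.conj, sat_and, ih, List.forall_mem_cons]

end Connectives

/-- The assignment `v` passed under a block of `N` quantifiers of sort `k`, whose variables
`(k, 0), …, (k, N - 1)` take the values `b 0, …, b (N - 1)`. -/
def pushBlock {M : Type} (k : S.Srt) (N : ℕ) (b : ℕ → M) (v : S.Var → M) (p : S.Var) : M :=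
  if p.1 = k then (if p.2 < N then b p.2 else v (p.1, p.2 - N)) else v p

lemma push_pushBlock {M : Type} (k : S.Srt) (N : ℕ) (c : M) (b : ℕ → M) (v : S.Var → M) :
    push k c (pushBlock k N b v) = pushBlock k (N + 1) (fun | 0 => c | i + 1 => b i) v := by
  funext ⟨l, i⟩
  cases i <;> by_cases h : l = k <;> simp [push, pushBlock, h]

@[simp] lemma pushBlock_zero {M : Type} (k : S.Srt) (b : ℕ → M) (v : S.Var → M) :
    pushBlock k 0 b v = v := by
  funext ⟨l, i⟩; simp [pushBlock]

lemma sat_allBlock (I : Interp S) (k : S.Srt) (N : ℕ) (φ : Formula S) (v : S.Var → I.carrier) :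
    Sat I (.allBlock k N φ) v ↔
      ∀ b : ℕ → I.carrier, (∀ i < N, b i ∈ I.dom k) → Sat I φ (pushBlock k N b v) := by
  induction N generalizing φ with
  | zero =>
    simp only [Formula.allBlock, pushBlock_zero, Nat.not_lt_zero, IsEmpty.forall_iff, implies_true,
      forall_const]
    exact ⟨fun h _ => h, fun h => h fun _ => v (k, 0)⟩
  | succ N ih =>
    simp only [Formula.allBlock, ih, sat_all, push_pushBlock]
    constructor
    · intro h b hb
      have := h (fun i => b (i + 1)) (fun i hi => hb _ (by omega)) (b 0) (hb 0 (by omega))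
      convert this using 2
      funext i; cases i <;> rfl
    · intro h b hb c hc
      refine h _ fun i hi => ?_
      cases i with
      | zero => exact hc
      | succ i => exact hb i (by omega)

lemma sat_exBlock (I : Interp S) (k : S.Srt) (N : ℕ) (φ : Formula S) (v : S.Var → I.carrier) :
    Sat I (.exBlock k N φ) v ↔
      ∃ b : ℕ → I.carrier, (∀ i < N, b i ∈ I.dom k) ∧ Sat I φ (pushBlock k N b v) := by
  induction N generalizing φ with
  | zero => simpa [Formula.exBlock] using fun _ => ⟨v (k, 0)⟩
  | succ N ih =>
    simp only [Formula.exBlock, ih, sat_ex, push_pushBlock]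
    constructor
    · rintro ⟨b, hb, c, hc, h⟩
      refine ⟨_, fun i hi => ?_, h⟩
      cases i with
      | zero => exact hc
      | succ i => exact hb i (by omega)
    · rintro ⟨b, hb, h⟩
      refine ⟨fun i => b (i + 1), fun i hi => hb _ (by omega), b 0, hb 0 (by omega), ?_⟩
      convert h using 2
      funext i; cases i <;> rfl

lemma push_shift {M : Type} (k : S.Srt) (b : M) (v : S.Var → M) (p : S.Var) :
    push k b v (shift k p) = v p := by
  obtain ⟨l, i⟩ := p
  by_cases h : l = k
  · simp [shift, h, push]
  · cases i <;> simp [shift, h, push]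

lemma eval_subst (I : Interp S) (t : S.Term) (σ : S.Var → S.Term) (v : S.Var → I.carrier) :
    I.eval v (t.subst σ) = I.eval (fun p => I.eval v (σ p)) t :=
  FirstOrder.Language.Term.realize_subst

lemma eval_relabel (I : Interp S) (t : S.Term) (ρ : S.Var → S.Var) (v : S.Var → I.carrier) :
    I.eval v (t.relabel ρ) = I.eval (v ∘ ρ) t :=
  FirstOrder.Language.Term.realize_relabel

@[simp] lemma eval_var (I : Interp S) (p : S.Var) (v : S.Var → I.carrier) :
    I.eval v (.var p) = v p := rfl

lemma eval_up (I : Interp S) (k : S.Srt) (σ : S.Var → S.Term) (b : I.carrier)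
    (v : S.Var → I.carrier) (p : S.Var) :
    I.eval (push k b v) (up k σ p) = push k b (fun q => I.eval v (σ q)) p := by
  have key : ∀ t : S.Term, I.eval (push k b v) (t.relabel (shift k)) = I.eval v t := fun t => by
    rw [eval_relabel]
    congr 1; funext q; exact push_shift k b v q
  obtain ⟨l, i⟩ := p
  cases i <;> by_cases h : l = k <;> simp [up, push, h, key]

/-- The semantic substitution lemma. -/
lemma sat_subst (I : Interp S) (φ : Formula S) (σ : S.Var → S.Term) (v : S.Var → I.carrier) :
    Sat I (φ.subst σ) v ↔ Sat I φ (fun p => I.eval v (σ p)) := by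
  induction φ generalizing σ v with
  | falsum => rfl
  | equal t u => simp [Formula.subst, eval_subst]
  | rel R ts => simp [Formula.subst, Sat, eval_subst]
  | imp φ ψ ih₁ ih₂ => simp [Formula.subst, ih₁, ih₂]
  | all k φ ih =>
    simp only [Formula.subst, sat_all, ih]
    refine forall₂_congr fun b _ => ?_
    rw [show (fun p => I.eval (push k b v) (up k σ p)) = _ from funext (eval_up I k σ b v)]

lemma sat_rename (I : Interp S) (φ : Formula S) (ρ : S.Var → S.Var) (v : S.Var → I.carrier) :
    Sat I (φ.rename ρ) v ↔ Sat I φ (fun p => v (ρ p)) := by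
  simp [Formula.rename, sat_subst]

lemma sat_lift (I : Interp S) (k : S.Srt) (φ : Formula S) (b : I.carrier) (v : S.Var → I.carrier) :
    Sat I (φ.lift k) (push k b v) ↔ Sat I φ v := by
  rw [Formula.lift, sat_rename]
  simp only [push_shift]

lemma sat_inst (I : Interp S) (k : S.Srt) (φ : Formula S) (t : S.Term) (v : S.Var → I.carrier) :
    Sat I (φ.inst k t) v ↔ Sat I φ (push k (I.eval v t) v) := by
  rw [Formula.inst, sat_subst]
  have : (fun p => I.eval v (instSubst k t p)) = push k (I.eval v t) v := by
    funext ⟨l, i⟩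
    cases i <;> by_cases h : l = k <;> simp [instSubst, push, h]
  rw [this]

/-- An assignment is well sorted if it gives the variables of each sort values in the range of that
sort. -/
def WellSorted (I : Interp S) (v : S.Var → I.carrier) : Prop := ∀ p : S.Var, v p ∈ I.dom p.1

lemma WellSorted.push {I : Interp S} {v : S.Var → I.carrier} (hv : WellSorted I v) {k : S.Srt}
    {b : I.carrier} (hb : b ∈ I.dom k) : WellSorted I (push k b v) := by
  rintro ⟨l, i⟩
  cases i <;> by_cases h : l = k
  · subst h; simpa [SetMatrixTheory.push] using hb
  · simpa [SetMatrixTheory.push, h] using hv (l, 0)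
  · subst h; simpa [SetMatrixTheory.push] using hv (l, _)
  · simpa [SetMatrixTheory.push, h] using hv (l, _)

lemma WellSorted.eval_mem {I : Interp S} {v : S.Var → I.carrier} (hv : WellSorted I v)
    {t : S.Term} {k : S.Srt} (ht : sortOf t ≤ k) : I.eval v t ∈ I.dom k := by
  cases t with
  | var p => exact I.dom_mono ht (hv p)
  | func f ts => exact I.dom_mono ht (I.funMap_mem f _)

/-- Soundness of the calculus for well-sorted assignments. -/
theorem Provable.sat {T : Set (Formula S)} {I : Interp S}
    (hT : ∀ φ ∈ T, ∀ v, WellSorted I v → Sat I φ v) {φ : Formula S} (h : Provable T φ)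
    (v : S.Var → I.carrier) (hv : WellSorted I v) : Sat I φ v := by
  induction h generalizing v with
  | ax h => exact hT _ h v hv
  | mp _ _ ih₁ ih₂ => exact ih₁ v hv (ih₂ v hv)
  | gen k _ ih => exact fun b hb => ih _ (hv.push hb)
  | imp_weaken φ ψ => exact fun h _ => h
  | imp_distrib φ ψ χ => exact fun h₁ h₂ h₃ => h₁ h₃ (h₂ h₃)
  | neg_neg φ => simp
  | all_inst k φ t ht => exact fun h => (sat_inst ..).2 (h _ (hv.eval_mem ht))
  | all_imp k φ ψ => exact fun h hφ b hb => h b hb ((sat_lift ..).2 hφ)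
  | eq_refl t => rfl
  | eq_subst k φ t u ht hu =>
    intro h hφ
    rw [sat_inst] at hφ ⊢
    rwa [← (show I.eval v t = I.eval v u from h)]

/-- A theory with a model is consistent. -/
theorem consistent_of_model {T : Set (Formula S)} (I : Interp S)
    (hT : ∀ φ ∈ T, ∀ v, WellSorted I v → Sat I φ v) (v : S.Var → I.carrier)
    (hv : WellSorted I v) : Consistent T :=
  fun h => h.sat hT v hv


/-! ### Derivations from hypotheses -/

section Deduction

variable {S : SortedLanguage} {T : Set (Formula S)} {φ ψ χ γ : Formula S} {Γ : List (Formula S)}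

lemma Provable.imp_self (φ : Formula S) : Provable T (.imp φ φ) :=
  ((Provable.imp_distrib φ (.imp φ φ) φ).mp (.imp_weaken ..)).mp (.imp_weaken ..)

/-- Derivability from hypotheses, to which the generalization rule is not applied. -/
def Entails (T : Set (Formula S)) : List (Formula S) → Formula S → Prop
  | [], φ => Provable T φ
  | γ :: Γ, φ => Entails T Γ (.imp γ φ)

lemma Provable.entails (h : Provable T φ) : Entails T Γ φ := by
  induction Γ generalizing φ with
  | nil => exact h
  | cons γ Γ ih => exact ih ((Provable.imp_weaken φ γ).mp h)

lemma Entails.mp (h₁ : Entails T Γ (.imp φ ψ)) (h₂ : Entails T Γ φ) : Entails T Γ ψ := by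
  induction Γ generalizing φ ψ with
  | nil => exact Provable.mp h₁ h₂
  | cons γ Γ ih => exact ih (ih (Provable.imp_distrib ..).entails h₁) h₂

lemma Entails.weaken (h : Entails T Γ φ) : Entails T (γ :: Γ) φ :=
  Entails.mp (Γ := Γ) (Provable.imp_weaken φ γ).entails h

lemma Entails.head : Entails T (φ :: Γ) φ := (Provable.imp_self φ).entails (Γ := Γ)

lemma Entails.intro (h : Entails T (φ :: Γ) ψ) : Entails T Γ (.imp φ ψ) := h

lemma Entails.by_contra (h : Entails T (φ.neg :: Γ) .falsum) : Entails T Γ φ :=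
  (Provable.neg_neg φ).entails.mp h

lemma Entails.exfalso (h : Entails T Γ .falsum) : Entails T Γ φ :=
  Entails.by_contra h.weaken

lemma Provable.trans (h₁ : Provable T (.imp φ ψ)) (h₂ : Provable T (.imp ψ χ)) :
    Provable T (.imp φ χ) :=
  Entails.mp (Γ := [φ]) (φ := ψ) h₂.entails h₁

lemma Provable.and_left (φ ψ : Formula S) : Provable T (.imp (φ.and ψ) φ) := by
  refine Entails.by_contra (Γ := [φ.and ψ]) (Entails.mp Entails.head.weaken ?_)
  exact Entails.intro (Entails.exfalso (Entails.mp Entails.head.weaken Entails.head))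

lemma Provable.and_right (φ ψ : Formula S) : Provable T (.imp (φ.and ψ) ψ) := by
  refine Entails.by_contra (Γ := [φ.and ψ]) (Entails.mp Entails.head.weaken ?_)
  exact Entails.intro Entails.head.weaken

/-- If `φ ∧ ψ` is refutable, then `φ` refutes `ψ`. -/
lemma Provable.imp_neg_of_neg_and (h : Provable T (φ.and ψ).neg) : Provable T (.imp φ ψ.neg) :=
  (Provable.neg_neg _).mp h

lemma Provable.neg_of_imp (h₁ : Provable T (.imp φ ψ)) (h₂ : Provable T (.imp φ ψ.neg)) :
    Provable T φ.neg :=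
  Entails.mp (Γ := [φ]) h₂ h₁

end Deduction

namespace ZF

/-! ### The syntax of the language of ZF -/

lemma term_cases (t : lang.Term) : (∃ i, t = x i) ∨ t = empt := by
  cases t with
  | var v => exact .inl ⟨v.2, rfl⟩
  | func f ts =>
    cases f
    exact .inr (congrArg _ (Subsingleton.elim _ _))

lemma rel_eq_mem {n : ℕ} (R : lang.symbols.Relations n) (ts : Fin n → lang.Term) :
    ∃ t u, Formula.rel R ts = mem t u := by
  cases R
  refine ⟨ts 0, ts 1, congrArg _ ?_⟩
  funext i; fin_cases i <;> rfl

@[elab_as_elim]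
lemma formula_induction {C : Formula lang → Prop} (falsum : C .falsum)
    (equal : ∀ t u, C (.equal t u)) (mem : ∀ t u, C (mem t u))
    (imp : ∀ φ ψ, C φ → C ψ → C (.imp φ ψ)) (all : ∀ φ, C φ → C (all φ)) (φ : Formula lang) :
    C φ := by
  induction φ with
  | falsum => exact falsum
  | equal t u => exact equal t u
  | rel R ts => obtain ⟨t, u, h⟩ := rel_eq_mem R ts; exact h ▸ mem t u
  | imp φ ψ h₁ h₂ => exact imp φ ψ h₁ h₂
  | all k φ h => exact all φ h

instance : Countable lang.Term := by
  refine Function.Surjective.countable (f := fun o : Option ℕ => o.elim empt x) fun t => ?_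
  obtain ⟨i, rfl⟩ | rfl := term_cases t
  · exact ⟨some i, rfl⟩
  · exact ⟨none, rfl⟩

/-- The formulas of depth at most `n`.  These countable sets exhaust the formulas. -/
def level : ℕ → Set (Formula lang)
  | 0 => {.falsum} ∪ Set.range (fun p : lang.Term × lang.Term => .equal p.1 p.2) ∪
      Set.range (fun p : lang.Term × lang.Term => mem p.1 p.2)
  | n + 1 => level n ∪ Set.image2 .imp (level n) (level n) ∪ all '' level n

lemma level_mono : Monotone level :=
  monotone_nat_of_le_succ fun _ _ h => .inl (.inl h)

lemma level_countable (n : ℕ) : (level n).Countable := by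
  induction n with
  | zero =>
    exact ((Set.countable_singleton _).union (Set.countable_range _)).union (Set.countable_range _)
  | succ n ih => exact (ih.union (ih.image2 ih _)).union (ih.image _)

instance : Countable (Formula lang) := by
  rw [← Set.countable_univ_iff]
  refine (Set.countable_iUnion level_countable).mono fun φ _ => Set.mem_iUnion.2 ?_
  induction φ using formula_induction with
  | falsum => exact ⟨0, .inl (.inl rfl)⟩
  | equal t u => exact ⟨0, .inl (.inr ⟨(t, u), rfl⟩)⟩
  | mem t u => exact ⟨0, .inr ⟨(t, u), rfl⟩⟩
  | imp φ ψ h₁ h₂ =>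
    obtain ⟨⟨m, hm⟩, ⟨n, hn⟩⟩ := And.intro (h₁ trivial) (h₂ trivial)
    exact ⟨max m n + 1, .inl (.inr ⟨φ, level_mono (le_max_left m n) hm, ψ,
      level_mono (le_max_right m n) hn, rfl⟩)⟩
  | all φ h =>
    obtain ⟨n, hn⟩ := h trivial
    exact ⟨n + 1, .inr ⟨φ, hn, rfl⟩⟩

/-- Renaming of the variables of a term along a map of labels. -/
def trelabel (t : lang.Term) (ρ : ℕ → ℕ) : lang.Term := t.subst (fun v => .var ((), ρ v.2))

@[simp] lemma trelabel_x (i : ℕ) (ρ : ℕ → ℕ) : trelabel (x i) ρ = x (ρ i) := rfl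

@[simp] lemma subst_empt (σ : lang.Var → lang.Term) : empt.subst σ = empt :=
  congrArg (FirstOrder.Language.Term.func (L := lang.symbols) FunSymbol.empty)
    (Subsingleton.elim _ _)

@[simp] lemma trelabel_empt (ρ : ℕ → ℕ) : trelabel empt ρ = empt := subst_empt _

@[simp] lemma relabel_equal (t u : lang.Term) (ρ : ℕ → ℕ) :
    relabel (.equal t u) ρ = .equal (trelabel t ρ) (trelabel u ρ) := rfl

lemma subst_mem (t u : lang.Term) (σ : lang.Var → lang.Term) :
    (mem t u).subst σ = mem (t.subst σ) (u.subst σ) := by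
  refine congrArg (Formula.rel (S := lang) MemSymbol.mem) ?_
  funext i; fin_cases i <;> rfl

@[simp] lemma relabel_mem (t u : lang.Term) (ρ : ℕ → ℕ) :
    relabel (mem t u) ρ = mem (trelabel t ρ) (trelabel u ρ) := subst_mem ..

@[simp] lemma relabel_imp (φ ψ : Formula lang) (ρ : ℕ → ℕ) :
    relabel (.imp φ ψ) ρ = .imp (relabel φ ρ) (relabel ψ ρ) := rfl

/-- A map of labels, passed under a quantifier. -/
def upLabel (ρ : ℕ → ℕ) : ℕ → ℕ
  | 0 => 0
  | i + 1 => ρ i + 1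

/-- The map of labels that replaces the variable of a stripped quantifier by the variable `k`. -/
def instLabel (k : ℕ) : ℕ → ℕ
  | 0 => k
  | i + 1 => i

@[simp] lemma relabel_all (φ : Formula lang) (ρ : ℕ → ℕ) :
    relabel (all φ) ρ = all (relabel φ (upLabel ρ)) := by
  refine congrArg (Formula.all (S := lang) ()) (congrArg _ ?_)
  funext ⟨_, i⟩
  cases i <;> rfl

lemma inst_x (φ : Formula lang) (k : ℕ) : φ.inst () (x k) = relabel φ (instLabel k) := by
  refine congrArg φ.subst ?_
  funext ⟨_, i⟩
  cases i <;> rfl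

lemma lift_eq (φ : Formula lang) : φ.lift () = relabel φ Nat.succ := rfl

lemma trelabel_trelabel (t : lang.Term) (ρ τ : ℕ → ℕ) :
    trelabel (trelabel t ρ) τ = trelabel t (τ ∘ ρ) := by
  obtain ⟨i, rfl⟩ | rfl := term_cases t <;> simp

lemma relabel_relabel (φ : Formula lang) (ρ τ : ℕ → ℕ) :
    relabel (relabel φ ρ) τ = relabel φ (τ ∘ ρ) := by
  induction φ using formula_induction generalizing ρ τ with
  | falsum => rfl
  | equal t u =>
    simp [trelabel_trelabel]
  | mem t u =>
    simp [trelabel_trelabel]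
  | imp φ ψ h₁ h₂ => simp [h₁, h₂]
  | all φ h =>
    rw [relabel_all, relabel_all, h, relabel_all]
    congr 2; funext i; cases i <;> rfl

lemma relabel_id (φ : Formula lang) : relabel φ id = φ := by
  have key : ∀ t, trelabel t id = t := fun t => by
    obtain ⟨i, rfl⟩ | rfl := term_cases t <;> simp
  induction φ using formula_induction with
  | falsum => rfl
  | equal t u => simp [key]
  | mem t u => simp [key]
  | imp φ ψ h₁ h₂ => simp [h₁, h₂]
  | all φ h =>
    rw [relabel_all, show upLabel id = id by funext i; cases i <;> rfl, h]

lemma exists_bound_term (t : lang.Term) :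
    ∃ N, ∀ ρ τ : ℕ → ℕ, (∀ i < N, ρ i = τ i) → trelabel t ρ = trelabel t τ := by
  obtain ⟨i, rfl⟩ | rfl := term_cases t
  · exact ⟨i + 1, fun ρ τ h => by simp [h i]⟩
  · exact ⟨0, fun ρ τ h => by simp⟩

/-- The labels of the free variables of a formula are bounded. -/
lemma exists_bound (φ : Formula lang) :
    ∃ N, ∀ ρ τ : ℕ → ℕ, (∀ i < N, ρ i = τ i) → relabel φ ρ = relabel φ τ := by
  induction φ using formula_induction with
  | falsum => exact ⟨0, fun _ _ _ => rfl⟩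
  | equal t u =>
    obtain ⟨⟨m, hm⟩, ⟨n, hn⟩⟩ := And.intro (exists_bound_term t) (exists_bound_term u)
    refine ⟨max m n, fun ρ τ h => ?_⟩
    rw [relabel_equal, relabel_equal, hm ρ τ fun i hi => h i (by omega),
      hn ρ τ fun i hi => h i (by omega)]
  | mem t u =>
    obtain ⟨⟨m, hm⟩, ⟨n, hn⟩⟩ := And.intro (exists_bound_term t) (exists_bound_term u)
    refine ⟨max m n, fun ρ τ h => ?_⟩
    rw [relabel_mem, relabel_mem, hm ρ τ fun i hi => h i (by omega),
      hn ρ τ fun i hi => h i (by omega)]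
  | imp φ ψ h₁ h₂ =>
    obtain ⟨⟨m, hm⟩, ⟨n, hn⟩⟩ := And.intro h₁ h₂
    refine ⟨max m n, fun ρ τ h => ?_⟩
    rw [relabel_imp, relabel_imp, hm ρ τ fun i hi => h i (by omega),
      hn ρ τ fun i hi => h i (by omega)]
  | all φ h =>
    obtain ⟨n, hn⟩ := h
    refine ⟨n, fun ρ τ h => ?_⟩
    rw [relabel_all, relabel_all, hn (upLabel ρ) (upLabel τ)]
    rintro (_ | i) hi
    · rfl
    · simp [upLabel, h i (by omega)]

/-! ### Complete Henkin sets -/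

variable {T : Set (Formula lang)}

lemma provable_relabel_instLabel {φ : Formula lang} (h : Provable T φ) (k : ℕ) :
    Provable T (relabel φ (instLabel k)) := by
  rw [← inst_x]
  exact (Provable.all_inst (S := lang) () φ (x k) le_rfl).mp (h.gen ())

/-- Theorems are closed under renaming of free variables.  Generalization followed by instantiation
replaces the variable `0` by an arbitrary one and lowers the other labels; finitely many such steps
make up any renaming of the variables that occur. -/
lemma provable_relabel {φ : Formula lang} (h : Provable T φ) (ρ : ℕ → ℕ) :
    Provable T (relabel φ ρ) := by
  have key : ∀ (N : ℕ) (ρ : ℕ → ℕ),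
      Provable T (relabel φ fun i => if i < N then ρ i else i - N) := by
    intro N
    induction N with
    | zero => intro ρ; simpa using (relabel_id φ).symm ▸ h
    | succ N ih =>
      intro ρ
      -- The last step lowers the labels already renamed, hence the `+ 1`.
      have := provable_relabel_instLabel (ih fun i => ρ i + 1) (ρ N)
      rw [relabel_relabel] at this
      convert this using 2
      funext i
      rcases lt_trichotomy i N with hi | rfl | hi
      · simp [hi, Nat.lt_succ_of_lt hi, instLabel]
      · simp [instLabel]
      · obtain ⟨j, rfl⟩ := Nat.exists_eq_add_of_lt hi
        have h₁ : ¬ N + j + 1 < N + 1 := by omega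
        have h₂ : ¬ N + j + 1 < N := by omega
        have h₃ : N + j + 1 - N = j + 1 := by omega
        have h₄ : N + j + 1 - (N + 1) = j := by omega
        simp only [Function.comp, h₁, h₂, h₃, h₄, if_false, instLabel]
  obtain ⟨N, hN⟩ := exists_bound φ
  rw [hN ρ (fun i => if i < N then ρ i else i - N) fun i hi => by simp [hi]]
  exact key N ρ

/-- A formula implies a universal statement as soon as it implies the instances by all variables:
among them is a fresh one. -/
lemma provable_all_of_forall_inst {φ ψ : Formula lang}
    (h : ∀ k, Provable T (.imp φ (ψ.inst () (x k)))) : Provable T (.imp φ (all ψ)) := by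
  obtain ⟨⟨m, hm⟩, ⟨n, hn⟩⟩ := And.intro (exists_bound φ) (exists_bound ψ)
  -- The variable `k` occurs neither in `φ` nor in `∀ ψ`; renaming it to `0` and raising all other
  -- labels turns `φ → ψ[k]` into the premise of `all_imp`.
  set k := max m n
  have h₁ := provable_relabel (h k) fun i => if i = k then 0 else i + 1
  rw [relabel_imp, inst_x, relabel_relabel, hm _ Nat.succ, hn _ id, relabel_id, ← lift_eq] at h₁
  · exact (Provable.all_imp (S := lang) () φ ψ).mp (h₁.gen ())
  · rintro (_ | i) hi
    · simp [instLabel]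
    · have : i ≠ k := by omega
      simp [instLabel, this]
  · intro i hi
    have : i ≠ k := by omega
    simp [this]

/-- The irrefutable formulas, the stronger ones above the weaker ones: the conditions of a forcing
argument for a complete Henkin set. -/
def Condition (T : Set (Formula lang)) : Type := {φ : Formula lang // ¬ Provable T φ.neg}

instance : Preorder (Condition T) where
  le φ ψ := Provable T (.imp ψ.1 φ.1)
  le_refl φ := .imp_self φ.1
  le_trans _ _ _ h₁ h₂ := h₂.trans h₁

/-- A condition either can be strengthened to decide `ψ` positively, or refutes it. -/
lemma Condition.exists_or_imp_neg (φ : Condition T) (ψ : Formula lang) :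
    (∃ χ : Condition T, φ ≤ χ ∧ Provable T (.imp χ.1 ψ)) ∨ Provable T (.imp φ.1 ψ.neg) := by
  by_cases h : Provable T (φ.1.and ψ).neg
  · exact .inr h.imp_neg_of_neg_and
  · exact .inl ⟨⟨_, h⟩, .and_left .., .and_right ..⟩

/-- The conditions that decide `ψ`. -/
def decides (T : Set (Formula lang)) (ψ : Formula lang) : Order.Cofinal (Condition T) where
  carrier := {φ | Provable T (.imp φ.1 ψ) ∨ Provable T (.imp φ.1 ψ.neg)}
  isCofinal φ := by
    obtain ⟨χ, h₁, h₂⟩ | h := φ.exists_or_imp_neg ψ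
    · exact ⟨χ, .inl h₂, h₁⟩
    · exact ⟨φ, .inr h, le_rfl⟩

/-- The conditions that imply `∀ ψ` or refute an instance of `ψ` by a variable. -/
def witnesses (T : Set (Formula lang)) (ψ : Formula lang) : Order.Cofinal (Condition T) where
  carrier := {φ | Provable T (.imp φ.1 (all ψ)) ∨
    ∃ k, Provable T (.imp φ.1 (ψ.inst () (x k)).neg)}
  isCofinal φ := by
    by_cases h : ∃ k, ∃ χ : Condition T, φ ≤ χ ∧ Provable T (.imp χ.1 (ψ.inst () (x k)).neg)
    · obtain ⟨k, χ, h₁, h₂⟩ := h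
      exact ⟨χ, .inr ⟨k, h₂⟩, h₁⟩
    · push Not at h
      refine ⟨φ, .inl (provable_all_of_forall_inst fun k => ?_), le_rfl⟩
      obtain ⟨χ, h₁, h₂⟩ | h' := φ.exists_or_imp_neg (ψ.inst () (x k)).neg
      · exact absurd h₂ (h k χ h₁)
      · exact h'.trans (.neg_neg _)

/-- A complete consistent set of formulas that contains the theorems of `T`, and in which the free
variables serve as witnesses. -/
structure IsHenkin (T G : Set (Formula lang)) : Prop where
  provable_mem : ∀ {φ}, Provable T φ → φ ∈ G
  mp : ∀ {φ ψ}, .imp φ ψ ∈ G → φ ∈ G → ψ ∈ G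
  falsum_notMem : .falsum ∉ G
  mem_or_neg_mem : ∀ φ, φ ∈ G ∨ φ.neg ∈ G
  all_mem : ∀ φ : Formula lang, (∀ k, φ.inst () (x k) ∈ G) → all φ ∈ G

/-- The formulas implied by a condition in a sufficiently generic ideal form a Henkin set. -/
theorem exists_isHenkin (hT : Consistent T) : ∃ G, IsHenkin T G := by
  have : Encodable (Formula lang ⊕ Formula lang) := Encodable.ofCountable _
  let top : Condition T := ⟨.imp .falsum .falsum, fun h => hT (h.mp (.imp_self _))⟩
  let J := Order.idealOfCofinals top (Sum.elim (decides T) (witnesses T))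
  have hJ : ∀ {φ ψ}, φ ∈ J → ψ ∈ J → ∃ χ : Condition T, χ ∈ J ∧ φ ≤ χ ∧ ψ ≤ χ :=
    fun h₁ h₂ => J.directed _ h₁ _ h₂
  have hcon : ∀ {χ : Condition T} {φ}, Provable T (.imp χ.1 φ) → Provable T (.imp χ.1 φ.neg) →
      False := fun {χ} _ h₁ h₂ => χ.2 (h₁.neg_of_imp h₂)
  have hdec : ∀ φ, ∃ χ ∈ J, Provable T (.imp χ.1 φ) ∨ Provable T (.imp χ.1 φ.neg) := fun φ => by
    obtain ⟨χ, h₁, h₂⟩ := Order.cofinal_meets_idealOfCofinals top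
      (Sum.elim (decides T) (witnesses T)) (.inl φ)
    exact ⟨χ, h₂, h₁⟩
  refine ⟨{φ | ∃ χ ∈ J, Provable T (.imp χ.1 φ)}, ?_, ?_, ?_, ?_, ?_⟩
  · intro φ h
    exact ⟨top, Order.mem_idealOfCofinals .., (Provable.imp_weaken ..).mp h⟩
  · rintro φ ψ ⟨χ₁, h₁, h₁'⟩ ⟨χ₂, h₂, h₂'⟩
    obtain ⟨χ, h, l₁, l₂⟩ := hJ h₁ h₂
    exact ⟨χ, h, ((Provable.imp_distrib ..).mp (Provable.trans l₁ h₁')).mp (Provable.trans l₂ h₂')⟩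
  · rintro ⟨χ, -, h⟩
    exact χ.2 h
  · intro φ
    obtain ⟨χ, h, h' | h'⟩ := hdec φ
    · exact .inl ⟨χ, h, h'⟩
    · exact .inr ⟨χ, h, h'⟩
  · intro φ hφ
    obtain ⟨χ, h₁, h₂⟩ := Order.cofinal_meets_idealOfCofinals top
      (Sum.elim (decides T) (witnesses T)) (.inr φ)
    obtain h₁ | ⟨k, h₁⟩ := h₁
    · exact ⟨χ, h₂, h₁⟩
    · obtain ⟨χ', h₃, h₄⟩ := hφ k
      obtain ⟨χ'', -, l₁, l₂⟩ := hJ h₂ h₃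
      exact (hcon (Provable.trans l₂ h₄) (Provable.trans l₁ h₁)).elim

namespace IsHenkin

variable {G : Set (Formula lang)} (hG : IsHenkin T G)
include hG

lemma neg_mem {φ : Formula lang} : φ.neg ∈ G ↔ φ ∉ G :=
  ⟨fun h h' => hG.falsum_notMem (hG.mp h h'), (hG.mem_or_neg_mem φ).resolve_left⟩

lemma imp_mem {φ ψ : Formula lang} : .imp φ ψ ∈ G ↔ (φ ∈ G → ψ ∈ G) := by
  refine ⟨hG.mp, fun h => ?_⟩
  by_cases hφ : φ ∈ G
  · exact hG.mp (hG.provable_mem (.imp_weaken ..)) (h hφ)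
  · have : Provable T (.imp φ.neg (.imp φ ψ)) :=
      Entails.exfalso (Γ := [φ, φ.neg]) (Entails.mp Entails.head.weaken Entails.head)
    exact hG.mp (hG.provable_mem this) (hG.neg_mem.2 hφ)

lemma all_mem_iff {φ : Formula lang} : all φ ∈ G ↔ ∀ k, φ.inst () (x k) ∈ G :=
  ⟨fun h k => hG.mp (hG.provable_mem (.all_inst (S := lang) () φ (x k) le_rfl)) h, hG.all_mem φ⟩

lemma eq_subst_mem (φ : Formula lang) {t u : lang.Term} (h : .equal t u ∈ G)
    (ht : φ.inst () t ∈ G) : φ.inst () u ∈ G :=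
  hG.mp (hG.mp (hG.provable_mem (.eq_subst (S := lang) () φ t u le_rfl le_rfl)) h) ht

end IsHenkin

@[simp] lemma subst_trelabel_succ (t u : lang.Term) :
    (trelabel u Nat.succ).subst (instSubst (S := lang) () t) = u := by
  obtain ⟨i, rfl⟩ | rfl := term_cases u
  · rfl
  · simp

@[simp] lemma subst_x_zero (t : lang.Term) : (x 0).subst (instSubst (S := lang) () t) = t := rfl

namespace IsHenkin

variable {G : Set (Formula lang)} (hG : IsHenkin T G)
include hG

lemma eq_refl_mem (t : lang.Term) : .equal t t ∈ G := hG.provable_mem (.eq_refl t)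

lemma eq_symm_mem {t u : lang.Term} (h : .equal t u ∈ G) : .equal u t ∈ G := by
  have := hG.eq_subst_mem (.equal (x 0) (trelabel t Nat.succ)) h
  simp only [Formula.inst, Formula.subst, subst_x_zero, subst_trelabel_succ] at this
  exact this (hG.eq_refl_mem t)

lemma eq_trans_mem {s t u : lang.Term} (h : .equal s t ∈ G) (h' : .equal t u ∈ G) :
    .equal s u ∈ G := by
  have := hG.eq_subst_mem (.equal (trelabel s Nat.succ) (x 0)) h'
  simp only [Formula.inst, Formula.subst, subst_x_zero, subst_trelabel_succ] at this
  exact this h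

lemma mem_congr {s s' t t' : lang.Term} (h : .equal s s' ∈ G) (h' : .equal t t' ∈ G)
    (hm : mem s t ∈ G) : mem s' t' ∈ G := by
  have h₁ := hG.eq_subst_mem (mem (x 0) (trelabel t Nat.succ)) h
  have h₂ := hG.eq_subst_mem (mem (trelabel s' Nat.succ) (x 0)) h'
  simp only [Formula.inst, subst_mem, subst_x_zero, subst_trelabel_succ] at h₁ h₂
  exact h₂ (h₁ hm)

/-- Every term is equal to a variable. -/
lemma exists_eq_x (t : lang.Term) : ∃ k, .equal (x k) t ∈ G := by
  by_contra! h
  have h' : all (Formula.equal (x 0) (trelabel t Nat.succ)).neg ∈ G := by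
    rw [hG.all_mem_iff]
    intro k
    have := hG.neg_mem.2 (h k)
    simpa [Formula.inst, Formula.subst, Formula.neg] using this
  have := hG.mp (hG.provable_mem (.all_inst (S := lang) () _ t le_rfl)) h'
  simp only [Formula.inst, Formula.subst, Formula.neg, subst_x_zero, subst_trelabel_succ] at this
  exact hG.falsum_notMem (hG.mp this (hG.eq_refl_mem t))

/-- Terms are identified when the Henkin set contains their equality. -/
def setoid : Setoid lang.Term where
  r t u := .equal t u ∈ G
  iseqv := ⟨hG.eq_refl_mem, hG.eq_symm_mem, hG.eq_trans_mem⟩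

end IsHenkin

/-! ### The term model -/

/-- The interpretation of the language of ZF by a binary relation `E` and an element `e`. -/
abbrev ofMem {M : Type} (E : M → M → Prop) (e : M) : Interp lang where
  carrier := M
  str := ⟨fun _ _ => e, fun {n} R xs => match n, R, xs with | _, .mem, xs => E (xs 0) (xs 1)⟩
  dom _ := Set.univ
  dom_mono _ := subset_rfl
  funMap_mem _ _ := trivial

section ofMem

variable {M : Type} {E : M → M → Prop} {e : M} {v : lang.Var → M}

@[simp] lemma sat_mem (t u : lang.Term) :
    Sat (ofMem E e) (mem t u) v ↔
      E ((ofMem E e).eval v t) ((ofMem E e).eval v u) := Iff.rfl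

@[simp] lemma sat_all (φ : Formula lang) :
    Sat (ofMem E e) (all φ) v ↔ ∀ b : M, Sat (ofMem E e) φ (push () b v) :=
  forall_congr' fun _ => by simp

@[simp] lemma sat_ex (φ : Formula lang) :
    Sat (ofMem E e) (ex φ) v ↔ ∃ b : M, Sat (ofMem E e) φ (push () b v) :=
  (SetMatrixTheory.sat_ex ..).trans (exists_congr fun _ => by simp)

@[simp] lemma eval_x (i : ℕ) :
    (ofMem E e).eval v (x i) = v ((), i) := rfl

@[simp] lemma eval_empt : (ofMem E e).eval v empt = e := rfl

@[simp] lemma push_zero {b : M} : push (S := lang) () b v ((), 0) = b := rfl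

@[simp] lemma push_succ {b : M} {i : ℕ} : push (S := lang) () b v ((), i + 1) = v ((), i) := rfl

@[simp] lemma sat_relabel (φ : Formula lang) (ρ : ℕ → ℕ) :
    Sat (ofMem E e) (relabel φ ρ) v ↔ Sat (ofMem E e) φ (fun p => v ((), ρ p.2)) :=
  sat_rename ..

end ofMem

namespace IsHenkin

variable {G : Set (Formula lang)} (hG : IsHenkin T G)

/-- Membership between classes of terms. -/
def quotMem (a b : Quotient hG.setoid) : Prop :=
  Quotient.liftOn₂ a b (fun t u => mem t u ∈ G) fun _ _ _ _ h₁ h₂ =>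
    propext ⟨hG.mem_congr h₁ h₂, hG.mem_congr (hG.eq_symm_mem h₁) (hG.eq_symm_mem h₂)⟩

/-- The term model of a Henkin set. -/
abbrev termModel : Interp lang := ofMem hG.quotMem (Quotient.mk hG.setoid empt)

lemma eval_termModel (t : lang.Term) (ρ : ℕ → ℕ) :
    hG.termModel.eval (fun p => Quotient.mk hG.setoid (x (ρ p.2))) t =
      Quotient.mk hG.setoid (trelabel t ρ) := by
  obtain ⟨i, rfl⟩ | rfl := term_cases t <;> simp

/-- Truth in the term model is membership in the Henkin set. -/
lemma sat_termModel (φ : Formula lang) (ρ : ℕ → ℕ) :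
    Sat hG.termModel φ (fun p => Quotient.mk hG.setoid (x (ρ p.2))) ↔ relabel φ ρ ∈ G := by
  induction φ using formula_induction generalizing ρ with
  | falsum => exact iff_of_false id hG.falsum_notMem
  | equal t u =>
    rw [sat_equal, eval_termModel, eval_termModel, relabel_equal]
    exact Quotient.eq (r := hG.setoid)
  | mem t u =>
    rw [sat_mem, eval_termModel, eval_termModel, relabel_mem]
    rfl
  | imp φ ψ h₁ h₂ => rw [sat_imp, h₁, h₂, relabel_imp, hG.imp_mem]
  | all φ h =>
    rw [sat_all, relabel_all, hG.all_mem_iff]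
    have key : ∀ k, Sat hG.termModel φ (push () (Quotient.mk hG.setoid (x k))
        (fun p => Quotient.mk hG.setoid (x (ρ p.2)))) ↔
          (relabel φ (upLabel ρ)).inst () (x k) ∈ G := by
      intro k
      rw [inst_x, relabel_relabel, ← h]
      congr! 1
      funext ⟨_, i⟩
      cases i <;> rfl
    refine ⟨fun h k => (key k).1 (h _), fun h b => ?_⟩
    induction b using Quotient.ind with
    | _ t =>
      obtain ⟨k, hk⟩ := hG.exists_eq_x t
      rw [← show Quotient.mk hG.setoid (x k) = Quotient.mk hG.setoid t from Quotient.sound hk]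
      exact (key k).2 (h k)

end IsHenkin

/-- The completeness theorem for the language of ZF.  A theorem with free variables holds under
every assignment, because every element of the term model is the class of a variable. -/
theorem exists_model (hT : Consistent T) :
    ∃ (M : Type) (E : M → M → Prop) (e : M), ∀ φ, Provable T φ → ∀ v, Sat (ofMem E e) φ v := by
  obtain ⟨G, hG⟩ := exists_isHenkin hT
  refine ⟨_, hG.quotMem, Quotient.mk hG.setoid empt, fun φ h v => ?_⟩
  have : ∀ a : Quotient hG.setoid, ∃ k, Quotient.mk hG.setoid (x k) = a := fun a => by
    induction a using Quotient.ind with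
    | _ t => exact (hG.exists_eq_x t).imp fun k hk => Quotient.sound hk
  choose f hf using this
  have := (hG.sat_termModel φ fun i => f (v ((), i))).2 (hG.provable_mem (provable_relabel h _))
  simp only [hf] at this
  exact this

/-! ### Definability in models of ZF -/

/-- A model of ZF. -/
structure Model where
  carrier : Type
  mem : carrier → carrier → Prop
  empty : carrier
  sat : ∀ φ ∈ theory, ∀ v, Sat (ofMem mem empty) φ v

/-- The sequence `b, v 0, v 1, …`. -/
def cons {M : Type} (b : M) (v : ℕ → M) : ℕ → M
  | 0 => b
  | i + 1 => v i

@[simp] lemma cons_zero {M : Type} (b : M) (v : ℕ → M) : cons b v 0 = b := rfl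

@[simp] lemma cons_succ {M : Type} (b : M) (v : ℕ → M) (i : ℕ) : cons b v (i + 1) = v i := rfl

namespace Model

variable {U : Model}

/-- A property of assignments that a formula expresses. -/
def Def (P : (ℕ → U.carrier) → Prop) : Prop :=
  ∃ φ : Formula lang, ∀ v : ℕ → U.carrier, P v ↔ Sat (ofMem U.mem U.empty) φ (fun p => v p.2)

/-- A function of assignments whose graph is definable. -/
def DefFun (F : (ℕ → U.carrier) → U.carrier) : Prop :=
  Def fun v => v 0 = F fun i => v (i + 1)

variable {P Q : (ℕ → U.carrier) → Prop} {F G : (ℕ → U.carrier) → U.carrier}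

lemma Def.congr (hP : Def P) (h : ∀ v, Q v ↔ P v) : Def Q :=
  (funext fun v => propext (h v) : Q = P) ▸ hP

lemma Def.not (hP : Def P) : Def fun v => ¬ P v := by
  obtain ⟨φ, h⟩ := hP
  exact ⟨φ.neg, fun v => by simp [h]⟩

lemma Def.imp (hP : Def P) (hQ : Def Q) : Def fun v => P v → Q v := by
  obtain ⟨⟨φ, h⟩, ⟨ψ, h'⟩⟩ := And.intro hP hQ
  exact ⟨.imp φ ψ, fun v => by simp [h, h']⟩

lemma Def.and (hP : Def P) (hQ : Def Q) : Def fun v => P v ∧ Q v := by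
  obtain ⟨⟨φ, h⟩, ⟨ψ, h'⟩⟩ := And.intro hP hQ
  exact ⟨.and φ ψ, fun v => by simp [h, h']⟩

lemma Def.or (hP : Def P) (hQ : Def Q) : Def fun v => P v ∨ Q v := by
  obtain ⟨⟨φ, h⟩, ⟨ψ, h'⟩⟩ := And.intro hP hQ
  exact ⟨.or φ ψ, fun v => by simp [h, h']⟩

lemma Def.iff (hP : Def P) (hQ : Def Q) : Def fun v => P v ↔ Q v := by
  obtain ⟨⟨φ, h⟩, ⟨ψ, h'⟩⟩ := And.intro hP hQ
  exact ⟨.iff φ ψ, fun v => by simp [h, h']⟩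

lemma push_cons (b : U.carrier) (v : ℕ → U.carrier) :
    push (S := lang) () b (fun p => v p.2) = fun p => cons b v p.2 := by
  funext ⟨_, i⟩
  cases i <;> rfl

/-- The bound variable is put in front of the free ones, as the variable `0`. -/
lemma Def.all {R : (ℕ → U.carrier) → U.carrier → Prop}
    (h : Def fun v => R (fun i => v (i + 1)) (v 0)) : Def fun v => ∀ b, R v b := by
  obtain ⟨φ, h⟩ := h
  exact ⟨ZF.all φ, fun v => by simp [push_cons, ← h]⟩

lemma Def.ex {R : (ℕ → U.carrier) → U.carrier → Prop}
    (h : Def fun v => R (fun i => v (i + 1)) (v 0)) : Def fun v => ∃ b, R v b := by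
  obtain ⟨φ, h⟩ := h
  exact ⟨ZF.ex φ, fun v => by simp [push_cons, ← h]⟩

lemma Def.rename (hP : Def P) (ρ : ℕ → ℕ) : Def fun v => P fun i => v (ρ i) := by
  obtain ⟨φ, h⟩ := hP
  exact ⟨relabel φ ρ, fun v => by simp [h]⟩

lemma DefFun.rename (hF : DefFun F) (ρ : ℕ → ℕ) : DefFun fun v => F fun i => v (ρ i) :=
  Def.rename hF fun | 0 => 0 | i + 1 => ρ i + 1

lemma DefFun.var (i : ℕ) : DefFun (U := U) fun v => v i :=
  ⟨.equal (x 0) (x (i + 1)), fun v => by simp⟩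

lemma DefFun.empty : DefFun (U := U) fun _ => U.empty :=
  ⟨.equal (x 0) empt, fun v => by simp⟩

/-- The values of definable functions may be put into a definable relation. -/
lemma Def.rel {R : U.carrier → U.carrier → Prop} (hR : Def (U := U) fun v => R (v 0) (v 1))
    (hF : DefFun F) (hG : DefFun G) : Def fun v => R (F v) (G v) := by
  have : Def (U := U) fun v => ∃ a, a = F v ∧ ∃ b, b = G v ∧ R a b :=
    .ex (.and hF (.ex (.and (Def.rename hG fun | 0 => 0 | i + 1 => i + 2)
      (hR.rename fun | 0 => 1 | 1 => 0 | i + 2 => i))))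
  exact this.congr fun v => by simp

lemma Def.mem (hF : DefFun F) (hG : DefFun G) : Def fun v => U.mem (F v) (G v) :=
  .rel ⟨ZF.mem (x 0) (x 1), fun v => by simp⟩ hF hG

lemma Def.eq (hF : DefFun F) (hG : DefFun G) : Def fun v => F v = G v :=
  .rel (R := Eq) ⟨.equal (x 0) (x 1), fun v => by simp⟩ hF hG

/-- Definable functions may be put for the variables of a definable property. -/
lemma Def.comp (hP : Def P) {F : ℕ → (ℕ → U.carrier) → U.carrier} (hF : ∀ i, DefFun (F i)) :
    Def fun v => P fun i => F i v := by
  obtain ⟨φ, h⟩ := hP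
  refine Def.congr (P := fun v => Sat (ofMem U.mem U.empty) φ fun p => F p.2 v) ?_ fun v => h _
  clear h
  have term : ∀ (F : ℕ → (ℕ → U.carrier) → U.carrier), (∀ i, DefFun (F i)) → ∀ t : lang.Term,
      DefFun fun v => (ofMem U.mem U.empty).eval (fun p => F p.2 v) t := fun F hF t => by
    obtain ⟨i, rfl⟩ | rfl := term_cases t
    · exact hF i
    · exact DefFun.empty
  induction φ using formula_induction generalizing F with
  | falsum => exact ⟨.falsum, fun v => Iff.rfl⟩
  | equal t u => exact .eq (term F hF t) (term F hF u)
  | mem t u => exact .mem (term F hF t) (term F hF u)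
  | imp φ ψ h₁ h₂ => exact .imp (h₁ hF) (h₂ hF)
  | all φ ih =>
    have := ih (F := fun | 0 => fun v => v 0 | i + 1 => fun v => F i fun j => v (j + 1))
      (fun | 0 => .var 0 | i + 1 => (hF i).rename _)
    refine Def.congr (Def.all (R := fun v b => Sat (ofMem U.mem U.empty) φ
      fun p => cons b (fun i => F i v) p.2) (this.congr fun v => ?_)) fun v => ?_
    · congr! 1
      funext ⟨_, i⟩
      cases i <;> rfl
    · rw [sat_all]
      simp only [push_cons (U := U) _ fun i => F i v]

lemma DefFun.comp (hG : DefFun G) {F : ℕ → (ℕ → U.carrier) → U.carrier}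
    (hF : ∀ i, DefFun (F i)) : DefFun fun v => G fun i => F i v :=
  Def.comp hG (F := fun | 0 => fun v => v 0 | i + 1 => fun v => F i fun j => v (j + 1))
    (fun | 0 => .var 0 | i + 1 => (hF i).rename _)

lemma DefFun.app {f : U.carrier → U.carrier} (hf : DefFun (U := U) fun v => f (v 0))
    (hF : DefFun F) : DefFun fun v => f (F v) :=
  DefFun.comp hf (F := fun _ => F) fun _ => hF

lemma DefFun.app₂ {f : U.carrier → U.carrier → U.carrier}
    (hf : DefFun (U := U) fun v => f (v 0) (v 1)) (hF : DefFun F) (hG : DefFun G) :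
    DefFun fun v => f (F v) (G v) :=
  DefFun.comp hf (F := fun | 0 => F | _ + 1 => G) (fun | 0 => hF | _ + 1 => hG)

/-! ### Set theory in models of ZF -/

lemma ext {a b : U.carrier} (h : ∀ c, U.mem c a ↔ U.mem c b) : a = b := by
  have := U.sat _ .extensionality fun _ => a
  simp only [extensionality, sat_all, sat_iff, sat_equal, sat_mem, eval_x] at this
  exact (this a b).2 h

lemma ext_iff {a b : U.carrier} : a = b ↔ ∀ c, U.mem c a ↔ U.mem c b :=
  ⟨fun h => h ▸ fun _ => Iff.rfl, ext⟩

variable (U) in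
@[simp] lemma notMem_empty (a : U.carrier) : ¬ U.mem a U.empty := by
  have := U.sat _ .emptySet fun _ => a
  simp only [emptySet, sat_ex, sat_and, sat_equal, sat_all, sat_neg, sat_mem, eval_x, eval_empt,
    push_zero, push_succ] at this
  obtain ⟨b, rfl, h⟩ := this
  exact h a

/-- Separation, with the parameters `v`. -/
lemma exists_sep (hP : Def P) (v : ℕ → U.carrier) (a : U.carrier) :
    ∃ b, ∀ c, U.mem c b ↔ U.mem c a ∧ P (cons c v) := by
  obtain ⟨φ, h⟩ := hP.rename fun | 0 => 0 | i + 1 => i + 2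
  have := U.sat _ (.separation φ) fun p => v p.2
  simp only [separation, sat_all, sat_ex, sat_iff, sat_and, sat_mem, eval_x, push_zero, push_succ,
    sat_relabel] at this
  obtain ⟨b, hb⟩ := this a
  refine ⟨b, fun c => (hb c).trans (and_congr_right fun _ => ?_)⟩
  refine Iff.trans (iff_of_eq (congrArg _ ?_)) ((h (cons c (cons a v))).symm.trans
    (iff_of_eq (congrArg P ?_)))
  · funext ⟨_, i⟩
    rcases i with _ | _ | i <;> rfl
  · funext i
    cases i <;> rfl

/-- Replacement, with the parameters `v`. -/
lemma exists_replacement (hP : Def P) (v : ℕ → U.carrier) (a : U.carrier)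
    (ha : ∀ c, U.mem c a → ∃ d, ∀ d', P (cons d' (cons c v)) ↔ d' = d) :
    ∃ b, ∀ d, U.mem d b ↔ ∃ c, U.mem c a ∧ P (cons d (cons c v)) := by
  obtain ⟨φ, h⟩ := hP.rename fun | 0 => 0 | 1 => 1 | i + 2 => i + 3
  have := U.sat _ (.replacement φ) fun p => v p.2
  simp only [replacement, sat_all, sat_ex, sat_iff, sat_and, sat_imp, sat_mem, sat_equal, eval_x,
    push_zero, push_succ, sat_relabel] at this
  have key : ∀ (c d : U.carrier) (w : lang.Var → U.carrier),
      (∀ i, w ((), i) = cons d (cons c (cons a v)) i) →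
        (Sat (ofMem U.mem U.empty) φ w ↔ P (cons d (cons c v))) := fun c d w hw => by
    rw [show w = fun p => cons d (cons c (cons a v)) p.2 from funext fun p => hw p.2, ← h]
    refine iff_of_eq (congrArg P ?_)
    funext i
    rcases i with _ | _ | i <;> rfl
  obtain ⟨b, hb⟩ := this a fun c hc => by
    obtain ⟨d, hd⟩ := ha c hc
    refine ⟨d, fun d' => Iff.trans (key c d' _ ?_) (hd d')⟩
    rintro (_ | _ | _ | i) <;> rfl
  refine ⟨b, fun d => (hb d).trans (exists_congr fun c => and_congr_right fun _ => ?_)⟩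
  refine key c d _ ?_
  rintro (_ | _ | _ | i) <;> rfl

/-- The image of a set under a definable function is a set. -/
lemma exists_image (hF : DefFun F) (v : ℕ → U.carrier) (a : U.carrier) :
    ∃ b, ∀ d, U.mem d b ↔ ∃ c, U.mem c a ∧ d = F (cons c v) :=
  exists_replacement hF v a fun c _ => ⟨F (cons c v), fun _ => Iff.rfl⟩

lemma exists_upair (a b : U.carrier) : ∃ c, ∀ d, U.mem d c ↔ d = a ∨ d = b := by
  have := U.sat _ .pairing fun _ => a
  simp only [pairing, sat_all, sat_ex, sat_iff, sat_or, sat_mem, sat_equal, eval_x,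
    push_zero, push_succ] at this
  exact this a b

lemma exists_sUnion (a : U.carrier) : ∃ b, ∀ c, U.mem c b ↔ ∃ d, U.mem d a ∧ U.mem c d := by
  have := U.sat _ .union fun _ => a
  simp only [union, sat_all, sat_ex, sat_iff, sat_and, sat_mem, eval_x,
    push_zero, push_succ] at this
  exact this a

lemma exists_powerSet (a : U.carrier) :
    ∃ b, ∀ c, U.mem c b ↔ ∀ d, U.mem d c → U.mem d a := by
  have := U.sat _ .powerSet fun _ => a
  simp only [powerSet, sat_all, sat_ex, sat_iff, sat_imp, sat_mem, eval_x,
    push_zero, push_succ] at this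
  exact this a

variable (U) in
lemma exists_infinite : ∃ a, U.mem U.empty a ∧
    ∀ b, U.mem b a → ∃ c, U.mem c a ∧ ∀ d, U.mem d c ↔ d = b := by
  have := U.sat _ .infinity fun _ => U.empty
  simpa only [infinity, sat_all, sat_ex, sat_iff, sat_and, sat_imp, sat_mem, sat_equal, eval_x,
    eval_empt, push_zero, push_succ] using this

lemma regular {a b : U.carrier} (hb : U.mem b a) :
    ∃ c, U.mem c a ∧ ∀ d, U.mem d c → ¬ U.mem d a := by
  have := U.sat _ .regularity fun _ => a
  simp only [regularity, sat_all, sat_ex, sat_and, sat_neg, sat_imp, sat_mem, sat_equal, eval_x,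
    eval_empt, push_zero, push_succ] at this
  obtain ⟨c, h₁, h₂⟩ := this a fun h => notMem_empty U b (h ▸ hb)
  exact ⟨c, h₁, fun d h h' => h₂ ⟨d, h, h'⟩⟩

/-- The unordered pair `{a, b}`. -/
noncomputable def upair (a b : U.carrier) : U.carrier := (exists_upair a b).choose

@[simp] lemma mem_upair {a b c : U.carrier} : U.mem c (upair a b) ↔ c = a ∨ c = b :=
  (exists_upair a b).choose_spec c

lemma DefFun.upair (hF : DefFun F) (hG : DefFun G) : DefFun fun v => upair (F v) (G v) := by
  refine .app₂ ?_ hF hG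
  refine Def.congr (.all (R := fun v c => U.mem c (v 0) ↔ c = v 1 ∨ c = v 2) ?_)
    fun v => by simp [ext_iff]
  exact .iff (.mem (.var 0) (.var 1)) (.or (.eq (.var 0) (.var 2)) (.eq (.var 0) (.var 3)))

lemma notMem_self (a : U.carrier) : ¬ U.mem a a := fun h => by
  obtain ⟨c, h₁, h₂⟩ := regular (a := upair a a) (b := a) (by simp)
  obtain rfl : c = a := by simpa using h₁
  exact h₂ c h (by simp)

lemma mem_asymm {a b : U.carrier} (h : U.mem a b) : ¬ U.mem b a := fun h' => by
  obtain ⟨c, h₁, h₂⟩ := regular (a := upair a b) (b := a) (by simp)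
  obtain rfl | rfl : c = a ∨ c = b := by simpa using h₁
  · exact h₂ b h' (by simp)
  · exact h₂ a h (by simp)

lemma upair_self_inj {a b : U.carrier} (h : upair a a = upair b b) : a = b := by
  simpa using (ext_iff.1 h a).1 (by simp)

lemma upair_right_inj {a b c : U.carrier} (h : upair a b = upair a c) : b = c := by
  have h₁ := (ext_iff.1 h b).1 (by simp)
  have h₂ := (ext_iff.1 h c).2 (by simp)
  simp only [mem_upair] at h₁ h₂
  grind

/-- The ordered pair of Kuratowski. -/
noncomputable def opair (a b : U.carrier) : U.carrier := upair (upair a a) (upair a b)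

lemma DefFun.opair (hF : DefFun F) (hG : DefFun G) : DefFun fun v => opair (F v) (G v) :=
  .upair (.upair hF hF) (.upair hF hG)

lemma opair_inj {a b c d : U.carrier} (h : opair a b = opair c d) : a = c ∧ b = d := by
  have hac : a = c := by
    have h₁ := (ext_iff.1 h (upair a a)).1 (by simp [opair])
    simp only [opair, mem_upair] at h₁
    obtain h₁ | h₁ := h₁
    · exact upair_self_inj h₁
    · have : U.mem c (upair a a) := h₁ ▸ by simp
      simpa [eq_comm] using this
  subst hac
  exact ⟨rfl, upair_right_inj (upair_right_inj h)⟩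

/-- Cartesian products exist, as subsets of the double power set of `a ∪ b`. -/
lemma exists_prod (a b : U.carrier) :
    ∃ c, ∀ d, U.mem d c ↔ ∃ s, U.mem s a ∧ ∃ t, U.mem t b ∧ d = opair s t := by
  obtain ⟨u, hu⟩ := exists_sUnion (upair a b)
  obtain ⟨p, hp⟩ := exists_powerSet u
  obtain ⟨q, hq⟩ := exists_powerSet p
  have hP : Def (U := U) fun v => ∃ s, U.mem s (v 1) ∧ ∃ t, U.mem t (v 2) ∧ v 0 = opair s t :=
    .ex (.and (.mem (.var 0) (.var 2)) (.ex (.and (.mem (.var 0) (.var 4))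
      (.eq (.var 2) (.opair (.var 1) (.var 0))))))
  obtain ⟨c, hc⟩ := exists_sep hP (cons a fun _ => b) q
  refine ⟨c, fun d => (hc d).trans (and_iff_right_of_imp ?_)⟩
  rintro ⟨s, hs, t, ht, rfl⟩
  simp only [cons_zero, cons_succ] at hs ht
  simp only [opair, hq, hp, hu, mem_upair]
  rintro d (rfl | rfl) f hf <;> simp only [mem_upair] at hf
  · exact ⟨a, .inl rfl, by grind⟩
  · obtain rfl | rfl := hf
    · exact ⟨a, .inl rfl, hs⟩
    · exact ⟨b, .inr rfl, ht⟩

/-- The set `{…{∅}…}` with `n` pairs of braces. -/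
noncomputable def num (U : Model) : ℕ → U.carrier
  | 0 => U.empty
  | n + 1 => upair (num U n) (num U n)

lemma num_injective : Function.Injective U.num := by
  intro m
  induction m with
  | zero =>
    rintro (_ | n) h
    · rfl
    · exact absurd (ext_iff.1 h (U.num n)) (by simp [num])
  | succ m ih =>
    rintro (_ | n) h
    · exact absurd (ext_iff.1 h (U.num m)) (by simp [num])
    · rw [ih (upair_self_inj h)]

lemma DefFun.num (n : ℕ) : DefFun (U := U) fun _ => U.num n := by
  induction n with
  | zero => exact .empty
  | succ n ih => exact .upair ih ih

/-- The tuple of the members of a list, as an iterated ordered pair. -/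
noncomputable def tup : List U.carrier → U.carrier
  | [] => U.empty
  | a :: l => opair a (tup l)

lemma tup_inj {l l' : List U.carrier} (hl : l.length = l'.length) (h : tup l = tup l') :
    l = l' := by
  induction l generalizing l' with
  | nil => exact (List.length_eq_zero_iff.1 hl.symm).symm
  | cons a l ih =>
    cases l' with
    | nil => simp at hl
    | cons b l' =>
      obtain ⟨rfl, h'⟩ := opair_inj h
      rw [ih (by simpa using hl) h']

lemma DefFun.tup (l : List ((ℕ → U.carrier) → U.carrier)) (hl : ∀ F ∈ l, DefFun F) :
    DefFun fun v => tup (l.map fun F => F v) := by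
  induction l with
  | nil => exact .empty
  | cons F l ih =>
    exact .opair (hl F (by simp)) (ih fun G hG => hl G (by simp [hG]))

lemma exists_tuples (a : U.carrier) (n : ℕ) : ∃ b, ∀ c, U.mem c b ↔
    ∃ l : List U.carrier, l.length = n ∧ (∀ s ∈ l, U.mem s a) ∧ c = tup l := by
  induction n with
  | zero =>
    refine ⟨upair U.empty U.empty, fun c => ?_⟩
    simp [List.length_eq_zero_iff, tup]
  | succ n ih =>
    obtain ⟨b, hb⟩ := ih
    obtain ⟨d, hd⟩ := exists_prod a b
    refine ⟨d, fun c => (hd c).trans ⟨?_, ?_⟩⟩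
    · rintro ⟨s, hs, t, ht, rfl⟩
      obtain ⟨l, rfl, hl, rfl⟩ := (hb t).1 ht
      exact ⟨s :: l, rfl, by simpa [hs] using hl, rfl⟩
    · rintro ⟨_ | ⟨s, l⟩, hn, hl, rfl⟩
      · simp at hn
      · exact ⟨s, hl s (by simp), tup l, (hb _).2 ⟨l, by simpa using hn,
          fun t ht => hl t (by simp [ht]), rfl⟩, rfl⟩

/-! ### Sets and matrices inside a model of ZF -/

/-- The union of `a` and `{c | c = a ∧ P}` exists. -/
lemma exists_adjoin (P : Prop) (a : U.carrier) :
    ∃ b, ∀ c, U.mem c b ↔ U.mem c a ∨ c = a ∧ P := by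
  by_cases h : P
  · obtain ⟨b, hb⟩ := exists_sUnion (upair a (upair a a))
    refine ⟨b, fun c => (hb c).trans ?_⟩
    simp [h]
  · exact ⟨a, fun c => by simp [h]⟩

/-- The model element `a` has two different members. -/
def Many (a : U.carrier) : Prop := ∃ s, U.mem s a ∧ ∃ t, U.mem t a ∧ s ≠ t

/-- The element that represents, in the model of SMT, the set with the same members as `a`: it is
`a` if `a` has at most one member and `a ∪ {a}` otherwise. -/
noncomputable def code (a : U.carrier) : U.carrier := (exists_adjoin (Many a) a).choose

lemma mem_code {a c : U.carrier} : U.mem c (code a) ↔ U.mem c a ∨ c = a ∧ Many a :=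
  (exists_adjoin (Many a) a).choose_spec c

lemma mem_code_of_mem {a c : U.carrier} (h : U.mem c a) : U.mem c (code a) := mem_code.2 (.inl h)

lemma code_eq_self {a : U.carrier} (h : ¬ Many a) : code a = a := ext fun c => by simp [mem_code, h]

lemma not_many_of_forall_eq {a b : U.carrier} (h : ∀ c, U.mem c a → c = b) : ¬ Many a :=
  fun ⟨_, hs, _, ht, hne⟩ => hne ((h _ hs).trans (h _ ht).symm)

variable (U) in
@[simp] lemma code_empty : code U.empty = U.empty :=
  code_eq_self (not_many_of_forall_eq (b := U.empty) fun c h => (notMem_empty U c h).elim)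

lemma Many.code {a : U.carrier} (h : Many a) : Many (code a) := by
  obtain ⟨s, hs, t, ht, hne⟩ := h
  exact ⟨s, mem_code_of_mem hs, t, mem_code_of_mem ht, hne⟩

/-- If both `a` and `b` have two members, then `a ∪ {a} = b ∪ {b}` and `a ≠ b` would give
`a ∈ b ∈ a`.  If just one of them has two members, so does just one of the codes. -/
lemma code_injective : Function.Injective (code (U := U)) := by
  intro a b h
  by_cases ha : Many a <;> by_cases hb : Many b
  · by_contra hne
    have h₁ := (ext_iff.1 h a).1 (mem_code.2 (.inr ⟨rfl, ha⟩))
    have h₂ := (ext_iff.1 h b).2 (mem_code.2 (.inr ⟨rfl, hb⟩))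
    simp only [mem_code, hne, Ne.symm hne, false_and, or_false] at h₁ h₂
    exact mem_asymm h₁ h₂
  · exact absurd (code_eq_self hb ▸ h ▸ ha.code) hb
  · exact absurd (code_eq_self ha ▸ h.symm ▸ hb.code) ha
  · rwa [code_eq_self ha, code_eq_self hb] at h

/-- Sets with exactly two members are not codes: if `a` has two members, then `code a` has these
two and, by regularity, `a` as a third one. -/
lemma upair_ne_code {a b c : U.carrier} (h : a ≠ b) : upair a b ≠ code c := fun heq => by
  by_cases hc : Many c
  · have hm : ∀ d, U.mem d (code c) → d = a ∨ d = b := fun d hd => by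
      rw [← heq] at hd; exact mem_upair.1 hd
    have h₁ := hm c (mem_code.2 (.inr ⟨rfl, hc⟩))
    obtain ⟨s, hs, t, ht, hne⟩ := hc
    have h₂ := hm s (mem_code_of_mem hs)
    have h₃ := hm t (mem_code_of_mem ht)
    have h₄ : s ≠ c := fun h => notMem_self c (h ▸ hs)
    have h₅ : t ≠ c := fun h => notMem_self c (h ▸ ht)
    grind
  · rw [code_eq_self hc] at heq
    exact hc (heq ▸ ⟨a, by simp, b, by simp, h⟩)

lemma Def.many {F : (ℕ → U.carrier) → U.carrier} (hF : DefFun F) : Def fun v => Many (F v) := by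
  have : Def (U := U) fun v => Many (v 0) :=
    .ex (.and (.mem (.var 0) (.var 1)) (.ex (.and (.mem (.var 0) (.var 2))
      (.not (.eq (.var 1) (.var 0))))))
  exact this.comp (F := fun _ => F) fun _ => hF

lemma DefFun.code {F : (ℕ → U.carrier) → U.carrier} (hF : DefFun F) :
    DefFun fun v => code (F v) := by
  refine .app ?_ hF
  refine Def.congr (.all (R := fun v c => U.mem c (v 0) ↔ U.mem c (v 1) ∨ c = v 1 ∧ Many (v 1)) ?_)
    fun v => by simp [ext_iff, mem_code]
  exact .iff (.mem (.var 0) (.var 1)) (.or (.mem (.var 0) (.var 2))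
    (.and (.eq (.var 0) (.var 2)) (.many (.var 2))))

/-- Membership in the model of SMT: `b` represents a set that has `a` as a member. -/
def setMem (a b : U.carrier) : Prop := ∃ c, b = code c ∧ U.mem a c

@[simp] lemma setMem_code {a b : U.carrier} : setMem a (code b) ↔ U.mem a b :=
  ⟨fun ⟨_, h, h'⟩ => code_injective h ▸ h', fun h => ⟨b, rfl, h⟩⟩

lemma setMem.mem {a b : U.carrier} (h : setMem a b) : U.mem a b := by
  obtain ⟨c, rfl, h⟩ := h
  exact mem_code_of_mem h

lemma Def.setMem {F G : (ℕ → U.carrier) → U.carrier} (hF : DefFun F) (hG : DefFun G) :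
    Def fun v => setMem (F v) (G v) :=
  .rel (.ex (.and (.eq (.var 2) (.code (.var 0))) (.mem (.var 1) (.var 0)))) hF hG

/-- The `m × n` matrix with the entries coded by `t`.  It has the two members `∅` and `{w}`, where
`w` determines `m`, `n` and `t`. -/
noncomputable def box (m n : ℕ) (t : U.carrier) : U.carrier :=
  let w := opair (U.num m) (opair (U.num n) t)
  upair U.empty (upair w w)

lemma box_inj {m n p q : ℕ} {s t : U.carrier} (h : box m n s = box p q t) :
    m = p ∧ n = q ∧ s = t := by
  obtain ⟨h₁, h₂⟩ := opair_inj (upair_self_inj (upair_right_inj h))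
  obtain ⟨h₂, h₃⟩ := opair_inj h₂
  exact ⟨num_injective h₁, num_injective h₂, h₃⟩

lemma box_ne_code {m n : ℕ} {t a : U.carrier} : box m n t ≠ code a := by
  refine upair_ne_code fun h => ?_
  exact notMem_empty U _ ((ext_iff.1 h _).2 (by simp; rfl))

lemma DefFun.box (m n : ℕ) {F : (ℕ → U.carrier) → U.carrier} (hF : DefFun F) :
    DefFun fun v => box m n (F v) :=
  have := DefFun.opair (.num m) (.opair (.num n) hF)
  .upair .empty (.upair this this)

/-- The value of `f_{m × n}` in the model of SMT.  A `1 × 1` matrix is its entry. -/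
noncomputable def matrix (m n : ℕ+) (t : Fin ((m : ℕ) * (n : ℕ)) → U.carrier) : U.carrier :=
  if h : (m : ℕ) * (n : ℕ) = 1 then t ⟨0, by omega⟩ else box m n (tup (List.ofFn t))

lemma matrix_one (t : Fin (((1 : ℕ+) : ℕ) * ((1 : ℕ+) : ℕ)) → U.carrier) :
    matrix 1 1 t = t ⟨0, by simp⟩ := dif_pos (by simp)

lemma matrix_ne_code {m n : ℕ+} (h : (m : ℕ) * (n : ℕ) ≠ 1)
    (t : Fin ((m : ℕ) * (n : ℕ)) → U.carrier) (a : U.carrier) : matrix m n t ≠ code a := by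
  rw [matrix, dif_neg h]
  exact box_ne_code

lemma matrix_ne_matrix {m n p q : ℕ+} (h₁ : (m : ℕ) * (n : ℕ) ≠ 1) (h₂ : (p : ℕ) * (q : ℕ) ≠ 1)
    (h : (m, n) ≠ (p, q)) (s : Fin ((m : ℕ) * (n : ℕ)) → U.carrier)
    (t : Fin ((p : ℕ) * (q : ℕ)) → U.carrier) : matrix m n s ≠ matrix p q t := by
  rw [matrix, matrix, dif_neg h₁, dif_neg h₂]
  intro heq
  obtain ⟨hm, hn, -⟩ := box_inj heq
  exact h (by rw [PNat.coe_inj.1 hm, PNat.coe_inj.1 hn])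

lemma matrix_injective (m n : ℕ+) : Function.Injective (matrix (U := U) m n) := by
  intro s t h
  by_cases hmn : (m : ℕ) * (n : ℕ) = 1
  · rw [matrix, matrix, dif_pos hmn, dif_pos hmn] at h
    funext ⟨i, hi⟩
    obtain rfl : i = 0 := by omega
    exact h
  · rw [matrix, matrix, dif_neg hmn, dif_neg hmn] at h
    exact List.ofFn_injective (tup_inj (by simp) (box_inj h).2.2)

lemma DefFun.matrix (m n : ℕ+) {F : Fin ((m : ℕ) * (n : ℕ)) → (ℕ → U.carrier) → U.carrier}
    (hF : ∀ r, DefFun (F r)) : DefFun fun v => matrix m n fun r => F r v := by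
  by_cases hmn : (m : ℕ) * (n : ℕ) = 1
  · simpa only [ZF.Model.matrix, dif_pos hmn] using hF _
  · simp only [ZF.Model.matrix, dif_neg hmn]
    have := (DefFun.tup (List.ofFn F) fun G hG => by
      obtain ⟨r, rfl⟩ := (List.mem_ofFn' F G).1 hG
      exact hF r).box m n
    simpa only [List.map_ofFn, Function.comp_def] using this

/-- The `m × n` matrices with entries in a set form a set. -/
lemma exists_matrices (m n : ℕ+) (a : U.carrier) : ∃ b, ∀ c, U.mem c b ↔
    ∃ t : Fin ((m : ℕ) * (n : ℕ)) → U.carrier, c = matrix m n t ∧ ∀ r, U.mem (t r) a := by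
  by_cases hmn : (m : ℕ) * (n : ℕ) = 1
  · refine ⟨a, fun c => ?_⟩
    simp only [matrix, dif_pos hmn]
    exact ⟨fun h => ⟨fun _ => c, rfl, fun _ => h⟩, fun ⟨t, h, ht⟩ => h ▸ ht _⟩
  · obtain ⟨b, hb⟩ := exists_tuples a ((m : ℕ) * (n : ℕ))
    obtain ⟨d, hd⟩ := exists_image (DefFun.box m n (.var 0)) (fun _ => a) b
    refine ⟨d, fun c => (hd c).trans ?_⟩
    simp only [matrix, dif_neg hmn, cons_zero]
    constructor
    · rintro ⟨t, ht, rfl⟩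
      obtain ⟨l, hl, hla, rfl⟩ := (hb t).1 ht
      refine ⟨fun r => l.get (r.cast hl.symm), ?_, fun r => hla _ (List.get_mem ..)⟩
      congr 2
      exact List.ext_get (by simp [hl]) (by simp)
    · rintro ⟨t, rfl, ht⟩
      refine ⟨_, (hb _).2 ⟨List.ofFn t, by simp, fun s hs => ?_, rfl⟩, rfl⟩
      obtain ⟨r, rfl⟩ := (List.mem_ofFn' t s).1 hs
      exact ht r

end Model
end ZF

namespace SMT

open ZF (cons)
open ZF.Model

/-! ### The model of SMT -/

/-- The interpretation of SMT in a model of ZF: every element is a set matrix, and the sets are the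
codes. -/
noncomputable abbrev interp (U : ZF.Model) : Interp lang where
  carrier := U.carrier
  str := ⟨fun {n} f xs => match n, f, xs with
      | _, .empty, _ => U.empty
      | _, .mat m n, xs => matrix m n xs,
    fun {n} R xs => match n, R, xs with | _, .mem, xs => setMem (xs 0) (xs 1)⟩
  dom := fun
    | .set => Set.range code
    | .matrix => Set.univ
  dom_mono {k l} h := by
    cases k <;> cases l
    · exact subset_rfl
    · exact Set.subset_univ _
    · exact absurd h (by rintro (h | h) <;> cases h)
    · exact subset_rfl
  funMap_mem {n} f xs := by
    cases f with
    | empty => exact ⟨U.empty, code_empty U⟩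
    | mat m n => trivial

section Semantics

variable {U : ZF.Model} {v : lang.Var → U.carrier} {φ ψ : Formula lang}

@[simp] lemma sat_mem (t u : lang.Term) :
    Sat (interp U) (mem t u) v ↔ setMem ((interp U).eval v t) ((interp U).eval v u) := Iff.rfl

@[simp] lemma sat_allSet :
    Sat (interp U) (allSet φ) v ↔ ∀ b : U.carrier, Sat (interp U) φ (push Kind.set (code b) v) :=
  Set.forall_mem_range

@[simp] lemma sat_exSet :
    Sat (interp U) (exSet φ) v ↔ ∃ b : U.carrier, Sat (interp U) φ (push Kind.set (code b) v) :=
  (sat_ex ..).trans Set.exists_range_iff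

@[simp] lemma sat_allMat :
    Sat (interp U) (allMat φ) v ↔ ∀ b : U.carrier, Sat (interp U) φ (push Kind.matrix b v) :=
  forall_congr' fun _ => ⟨fun h => h trivial, fun h _ => h⟩

@[simp] lemma sat_exMat :
    Sat (interp U) (exMat φ) v ↔ ∃ b : U.carrier, Sat (interp U) φ (push Kind.matrix b v) :=
  (sat_ex ..).trans (exists_congr fun _ => ⟨fun h => h.2, fun h => ⟨trivial, h⟩⟩)

@[simp] lemma sat_allMats (N : ℕ) :
    Sat (interp U) (allMats N φ) v ↔
      ∀ b : ℕ → U.carrier, Sat (interp U) φ (pushBlock Kind.matrix N b v) :=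
  (sat_allBlock ..).trans (forall_congr' fun _ => ⟨fun h => h fun _ _ => trivial, fun h _ => h⟩)

@[simp] lemma sat_exMats (N : ℕ) :
    Sat (interp U) (exMats N φ) v ↔
      ∃ b : ℕ → U.carrier, Sat (interp U) φ (pushBlock Kind.matrix N b v) :=
  (sat_exBlock ..).trans (exists_congr fun _ => ⟨fun h => h.2, fun h => ⟨fun _ _ => trivial, h⟩⟩)

@[simp] lemma sat_conjEntries {m n : ℕ+} (φ : Fin m → Fin n → Formula lang) :
    Sat (interp U) (conjEntries φ) v ↔ ∀ r : Fin ((m : ℕ) * (n : ℕ)),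
      Sat (interp U) (φ (finProdFinEquiv.symm r).1 (finProdFinEquiv.symm r).2) v := by
  rw [conjEntries, sat_conj, List.forall_mem_ofFn_iff]

@[simp] lemma eval_x (i : ℕ) : (interp U).eval v (x i) = v (Kind.set, i) := rfl

@[simp] lemma eval_a (i : ℕ) : (interp U).eval v (a i) = v (Kind.matrix, i) := rfl

@[simp] lemma eval_empt : (interp U).eval v empt = U.empty := rfl

@[simp] lemma eval_mat {m n : ℕ+} (t : Matrix (Fin m) (Fin n) lang.Term) :
    (interp U).eval v (mat t) = matrix m n fun r =>
      (interp U).eval v (t (finProdFinEquiv.symm r).1 (finProdFinEquiv.symm r).2) := rfl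

@[simp] lemma eval_single (t : lang.Term) :
    (interp U).eval v (single t) = (interp U).eval v t :=
  (eval_mat (m := 1) (n := 1) fun _ _ => t).trans (matrix_one _)

@[simp] lemma eval_vars {m n : ℕ+} (c : ℕ) (r : Fin ((m : ℕ) * (n : ℕ))) :
    (interp U).eval v (vars m n c (finProdFinEquiv.symm r).1 (finProdFinEquiv.symm r).2) =
      v (Kind.matrix, c + r) := by
  rw [vars, eval_a, Prod.mk.eta, Equiv.apply_symm_apply]

variable {M : Type} {w : lang.Var → M} {b : M} {i : ℕ}

@[simp] lemma push_set_set_zero : push (S := lang) Kind.set b w (Kind.set, 0) = b := rfl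

@[simp] lemma push_set_set_succ :
    push (S := lang) Kind.set b w (Kind.set, i + 1) = w (Kind.set, i) := rfl

@[simp] lemma push_set_matrix :
    push (S := lang) Kind.set b w (Kind.matrix, i) = w (Kind.matrix, i) := by cases i <;> rfl

@[simp] lemma push_matrix_matrix_zero :
    push (S := lang) Kind.matrix b w (Kind.matrix, 0) = b := rfl

@[simp] lemma push_matrix_matrix_succ :
    push (S := lang) Kind.matrix b w (Kind.matrix, i + 1) = w (Kind.matrix, i) := rfl

@[simp] lemma push_matrix_set :
    push (S := lang) Kind.matrix b w (Kind.set, i) = w (Kind.set, i) := by cases i <;> rfl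

variable {N : ℕ} {c : ℕ → M}

@[simp] lemma pushBlock_set :
    pushBlock (S := lang) Kind.matrix N c w (Kind.set, i) = w (Kind.set, i) := rfl

@[simp] lemma pushBlock_matrix_fin (r : Fin N) :
    pushBlock (S := lang) Kind.matrix N c w (Kind.matrix, r) = c r :=
  (if_pos rfl).trans (if_pos r.2)

@[simp] lemma pushBlock_matrix_add :
    pushBlock (S := lang) Kind.matrix N c w (Kind.matrix, N + i) = w (Kind.matrix, i) :=
  (if_pos rfl).trans (by simp)

@[simp] lemma pushBlock_matrix_self :
    pushBlock (S := lang) Kind.matrix N c w (Kind.matrix, N) = w (Kind.matrix, 0) :=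
  pushBlock_matrix_add (i := 0)

/-- The assignment that `relabel φ ρ τ` passes on to `φ`. -/
def relabelAssignment (w : lang.Var → M) (ρ τ : ℕ → ℕ) : lang.Var → M
  | (Kind.set, i) => w (Kind.set, ρ i)
  | (Kind.matrix, i) => w (Kind.matrix, τ i)

@[simp] lemma sat_relabel (ρ τ : ℕ → ℕ) :
    Sat (interp U) (relabel φ ρ τ) v ↔ Sat (interp U) φ (relabelAssignment v ρ τ) := by
  rw [relabel, sat_rename]
  refine iff_of_eq (congrArg _ ?_)
  funext ⟨k, i⟩
  cases k <;> rfl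

end Semantics

/-! ### Definability of satisfaction -/

section Definability

variable {U : ZF.Model}

lemma defFun_eval (t : lang.Term) (c : lang.Var → ℕ) :
    DefFun (U := U) fun v => (interp U).eval (fun p => v (c p)) t := by
  induction t with
  | var p => exact .var _
  | func f ts ih =>
    cases f with
    | empty => exact .empty
    | mat m n => exact .matrix m n ih

/-- Satisfaction in the model of SMT is definable in the model of ZF. -/
lemma def_sat (φ : Formula lang) (c : lang.Var → ℕ) :
    Def (U := U) fun v => Sat (interp U) φ (fun p => v (c p)) := by
  induction φ generalizing c with
  | falsum => exact ⟨.falsum, fun _ => Iff.rfl⟩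
  | equal t u => exact .eq (defFun_eval t c) (defFun_eval u c)
  | rel R ts =>
    cases R
    exact .setMem (defFun_eval _ c) (defFun_eval _ c)
  | imp φ ψ h₁ h₂ => exact .imp (h₁ c) (h₂ c)
  | all k φ ih =>
    refine .all (.imp ?_ ((ih (push k 0 fun p => c p + 1)).congr fun v => ?_))
    · cases k with
      | set => exact .ex (.eq (.code (.var 0)) (.var 1))
      | matrix => exact (Def.eq (.var 0) (.var 0)).congr fun v => iff_of_true trivial rfl
    · refine iff_of_eq (congrArg _ ?_)
      funext ⟨l, i⟩
      cases i <;> by_cases h : l = k <;> simp [push, h]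

/-- An assignment can be read off a single sequence, along some numbering of the variables. -/
lemma exists_coding {M : Type} (u : lang.Var → M) :
    ∃ (c : lang.Var → ℕ) (w : ℕ → M), ∀ p, w (c p) = u p := by
  refine ⟨fun | (Kind.set, i) => 2 * i | (Kind.matrix, i) => 2 * i + 1,
    fun i => u (if i % 2 = 0 then Kind.set else Kind.matrix, i / 2), ?_⟩
  rintro ⟨_ | _, i⟩
  · simp
  · simp [Nat.add_mod, show (2 * i + 1) / 2 = i by omega]

lemma cons_push (k : Kind) (c : lang.Var → ℕ) (w : ℕ → U.carrier) (s : U.carrier) :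
    (fun p => cons s w (push (S := lang) k 0 (fun q => c q + 1) p)) =
      push k s fun p => w (c p) := by
  funext ⟨l, i⟩
  cases k <;> cases l <;> cases i <;> simp

/-- For fixed values of the other variables, the property of the value of the Greek variable `0`
that a formula expresses in the model of SMT is definable with parameters in the model of ZF. -/
lemma exists_def (φ : Formula lang) (u : lang.Var → U.carrier) :
    ∃ P, Def (U := U) P ∧ ∃ v, ∀ s, P (cons s v) ↔ Sat (interp U) φ (push Kind.matrix s u) := by
  obtain ⟨c, w, h⟩ := exists_coding u
  refine ⟨_, def_sat φ (push Kind.matrix 0 fun q => c q + 1), w, fun s => ?_⟩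
  rw [cons_push, funext h]

/-- The analogue of `exists_def` for the Greek variables `0` and `1`. -/
lemma exists_def₂ (φ : Formula lang) (u : lang.Var → U.carrier) :
    ∃ P, Def (U := U) P ∧ ∃ v, ∀ s t, P (cons s (cons t v)) ↔
      Sat (interp U) φ (push Kind.matrix s (push Kind.matrix t u)) := by
  obtain ⟨c, w, h⟩ := exists_coding u
  refine ⟨_, def_sat φ (push Kind.matrix 0 fun p => push Kind.matrix 0 (fun q => c q + 1) p + 1), w,
    fun s t => ?_⟩
  rw [cons_push Kind.matrix (push Kind.matrix 0 fun q => c q + 1), cons_push, funext h]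

end Definability

/-! ### The axioms of SMT in the model -/

section Axioms

variable (U : ZF.Model) (v : lang.Var → U.carrier)

lemma mul_ne_one {m n : ℕ+} (h : (m, n) ≠ (1, 1)) : (m : ℕ) * (n : ℕ) ≠ 1 := fun h' => by
  obtain ⟨h₁, h₂⟩ := mul_eq_one.1 h'
  exact h (by rw [PNat.coe_eq_one_iff.1 h₁, PNat.coe_eq_one_iff.1 h₂])

lemma mul_ne_one_of_two_le {m n : ℕ+} (h : 2 ≤ m * n) : (m : ℕ) * (n : ℕ) ≠ 1 := fun h' => by
  have : ((2 : ℕ+) : ℕ) ≤ (m * n : ℕ+) := PNat.coe_le_coe _ _ |>.2 h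
  rw [PNat.mul_coe, h'] at this
  exact absurd this (by decide)

lemma sat_setMatrix (m n : ℕ+) : Sat (interp U) (setMatrix m n) v := by
  simp only [setMatrix, sat_allMats, sat_exMat, sat_equal, eval_a, eval_mat, eval_vars,
    push_matrix_matrix_zero, Nat.add_comm 1, push_matrix_matrix_succ]
  exact fun _ => ⟨_, rfl⟩

lemma sat_reduction : Sat (interp U) reduction v := by
  simp [reduction]

lemma sat_omission (m n : ℕ+) : Sat (interp U) (omission m n) v := by
  simp [omission]

lemma sat_divisionSet {m n : ℕ+} (h : 2 ≤ m * n) : Sat (interp U) (divisionSet m n) v := by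
  simp only [divisionSet, sat_allSet, sat_allMats, sat_neg, sat_equal, eval_mat, eval_x]
  exact fun a b h' => matrix_ne_code (mul_ne_one_of_two_le h) _ a h'.symm

lemma sat_divisionMatrix {m n p q : ℕ+} (h₁ : (1, 1) ≠ (m, n)) (h₂ : (m, n) ≠ (p, q))
    (h₃ : (p, q) ≠ (1, 1)) : Sat (interp U) (divisionMatrix m n p q) v := by
  simp only [divisionMatrix, sat_allMats, sat_neg, sat_equal, eval_mat]
  exact fun a b => matrix_ne_matrix (mul_ne_one h₁.symm) (mul_ne_one h₃) h₂ _ _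

lemma sat_epsilon {m n : ℕ+} (h : 2 ≤ m * n) : Sat (interp U) (epsilon m n) v := by
  simp only [epsilon, sat_allMats, sat_allMat, sat_neg, sat_mem, eval_mat]
  exact fun a b ⟨c, hc, _⟩ => matrix_ne_code (mul_ne_one_of_two_le h) _ c hc

lemma sat_matrixExtensionality (m n : ℕ+) : Sat (interp U) (matrixExtensionality m n) v := by
  simp only [matrixExtensionality, sat_allMats, sat_iff, sat_equal, eval_mat, sat_conjEntries,
    (matrix_injective m n).eq_iff, funext_iff, implies_true]

lemma sat_extensionality : Sat (interp U) extensionality v := by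
  simp only [extensionality, sat_allSet, sat_allMat, sat_iff, sat_equal, sat_mem, eval_x, eval_a,
    push_set_set_zero, push_set_set_succ, push_matrix_set, push_matrix_matrix_zero, setMem_code,
    code_injective.eq_iff]
  exact fun a b => ext_iff

lemma sat_emptySet : Sat (interp U) emptySet v := by
  simp only [emptySet, sat_exSet, sat_and, sat_allMat, sat_neg, sat_equal, sat_mem, eval_x, eval_a,
    eval_empt, push_set_set_zero, push_matrix_set, push_matrix_matrix_zero, setMem_code]
  exact ⟨U.empty, code_empty U, notMem_empty U⟩

lemma sat_separation (Φ : Formula lang) : Sat (interp U) (separation Φ) v := by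
  simp only [separation, sat_allSet, sat_exSet, sat_and, sat_allMat, sat_iff, sat_mem, eval_x,
    eval_a, push_set_set_zero, push_set_set_succ, push_matrix_set, push_matrix_matrix_zero,
    setMem_code, sat_relabel]
  intro a
  obtain ⟨P, hP, w, hw⟩ := exists_def Φ (push Kind.set (code a) v)
  obtain ⟨b, hb⟩ := exists_sep hP w a
  refine ⟨b, fun c => (hb c).trans (and_congr_right fun _ => (hw c).trans ?_)⟩
  refine iff_of_eq (congrArg _ ?_)
  funext ⟨k, i⟩
  cases k <;> cases i <;> simp [relabelAssignment]

lemma sat_pairing : Sat (interp U) pairing v := by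
  simp only [pairing, sat_exSet, sat_allMat, sat_iff, sat_or, sat_equal, sat_mem, eval_x,
    eval_a, push_set_set_zero, push_matrix_set, push_set_matrix, push_matrix_matrix_zero,
    push_matrix_matrix_succ, setMem_code]
  exact exists_upair

lemma sat_union : Sat (interp U) union v := by
  simp only [union, sat_allSet, sat_exSet, sat_allMat, sat_iff, sat_and, sat_imp, sat_mem,
    eval_x, eval_a, push_set_set_zero, push_set_set_succ, push_matrix_set, push_set_matrix,
    push_matrix_matrix_zero, setMem_code]
  intro a _
  obtain ⟨b, hb⟩ := exists_sUnion a
  have hP : Def (U := U) fun w => ∃ d, U.mem (code d) (w 1) ∧ U.mem (w 0) d :=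
    .ex (.and (.mem (.code (.var 0)) (.var 2)) (.mem (.var 1) (.var 0)))
  -- Since `d ⊆ code d`, the members of the sets in `a` are among those of the union of `a` in `U`.
  obtain ⟨c, hc⟩ := exists_sep hP (fun _ => a) b
  refine ⟨c, fun d => (hc d).trans (and_iff_right_of_imp ?_)⟩
  rintro ⟨s, h₁, h₂⟩
  exact (hb d).2 ⟨_, h₁, mem_code_of_mem h₂⟩

lemma sat_powerSet : Sat (interp U) powerSet v := by
  simp only [powerSet, sat_allSet, sat_exSet, sat_allMat, sat_iff, sat_and, sat_imp, sat_mem,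
    sat_equal, eval_x, eval_a, push_set_set_zero, push_set_set_succ, push_matrix_set,
    push_set_matrix, push_matrix_matrix_zero, setMem_code]
  intro a
  obtain ⟨b, hb⟩ := exists_powerSet a
  obtain ⟨c, hc⟩ := exists_image (DefFun.code (.var 0)) (fun _ => a) b
  refine ⟨c, fun d => (hc d).trans (exists_congr fun s => ?_)⟩
  rw [hb, and_comm, eq_comm]
  rfl

lemma sat_infinity : Sat (interp U) infinity v := by
  simp only [infinity, sat_allSet, sat_exSet, sat_allMat, sat_iff, sat_and, sat_imp, sat_mem,
    sat_equal, eval_x, eval_a, eval_empt, push_set_set_zero, push_set_set_succ, push_matrix_set,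
    push_matrix_matrix_zero, setMem_code]
  obtain ⟨a, h₁, h₂⟩ := exists_infinite U
  refine ⟨a, h₁, fun b hb => ?_⟩
  obtain ⟨c, hc, h⟩ := h₂ _ hb
  refine ⟨c, ?_, h⟩
  -- `c` is a singleton, hence its own code
  rwa [code_eq_self (not_many_of_forall_eq fun d hd => (h d).1 hd)]

lemma sat_replacement (Φ : Formula lang) : Sat (interp U) (replacement Φ) v := by
  simp only [replacement, sat_allSet, sat_exSet, sat_allMat, sat_exMat, sat_iff, sat_and, sat_imp,
    sat_mem, sat_equal, eval_x, eval_a, push_set_set_zero, push_set_set_succ, push_matrix_set,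
    push_matrix_matrix_zero, push_matrix_matrix_succ, setMem_code, sat_relabel]
  intro a ha
  obtain ⟨P, hP, w, hw⟩ := exists_def₂ Φ (push Kind.set (code a) v)
  obtain ⟨b, hb⟩ := exists_replacement hP w a fun c hc => (ha c hc).imp fun d hd d' => by
    refine ((hw d' c).trans (iff_of_eq (congrArg _ ?_))).trans (hd d')
    funext ⟨k, i⟩
    rcases k with _ | _ <;> rcases i with _ | _ | i <;> simp [relabelAssignment]
  refine ⟨b, fun d => (hb d).trans (exists_congr fun c => and_congr_right fun _ =>
    (hw d c).trans (iff_of_eq (congrArg _ ?_)))⟩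
  funext ⟨k, i⟩
  rcases k with _ | _ <;> rcases i with _ | _ | i <;> simp [relabelAssignment]

lemma sat_setOfSetMatrices (m n : ℕ+) : Sat (interp U) (setOfSetMatrices m n) v := by
  simp only [setOfSetMatrices, sat_allSet, sat_exSet, sat_allMat, sat_exMats, sat_iff, sat_and,
    sat_mem, sat_equal, sat_conjEntries, eval_x, eval_a, eval_mat, eval_vars, push_set_set_zero,
    push_set_set_succ, push_matrix_set, push_matrix_matrix_zero, pushBlock_set,
    pushBlock_matrix_self, pushBlock_matrix_fin, zero_add, setMem_code]
  intro a
  obtain ⟨b, hb⟩ := exists_matrices m n a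
  refine ⟨b, fun c => (hb c).trans ⟨?_, ?_⟩⟩
  · rintro ⟨t, rfl, ht⟩
    exact ⟨fun i => if h : i < m * n then t ⟨i, h⟩ else a, by simp, by simpa using ht⟩
  · rintro ⟨t, rfl, ht⟩
    exact ⟨_, rfl, ht⟩

lemma sat_regularity : Sat (interp U) regularity v := by
  simp only [regularity, sat_allSet, sat_exMat, sat_and, sat_neg, sat_imp, sat_mem, sat_equal,
    eval_x, eval_a, eval_empt, push_set_set_zero, push_matrix_set, push_matrix_matrix_zero,
    push_matrix_matrix_succ, setMem_code]
  intro a ha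
  obtain ⟨b, hb⟩ : ∃ b, U.mem b a := by
    by_contra! h
    refine ha ?_
    rw [ext fun c => iff_of_false (h c) (notMem_empty U c), code_empty]
  obtain ⟨c, h₁, h₂⟩ := regular hb
  exact ⟨c, h₁, fun ⟨d, h, h'⟩ => h₂ d h.mem h'⟩

theorem sat_of_isAxiom {φ : Formula lang} (h : IsAxiom φ) : Sat (interp U) φ v := by
  cases h with
  | setMatrix m n => exact sat_setMatrix U v m n
  | reduction => exact sat_reduction U v
  | omission m n => exact sat_omission U v m n
  | divisionSet m n h => exact sat_divisionSet U v h
  | divisionMatrix m n p q h₁ h₂ h₃ => exact sat_divisionMatrix U v h₁ h₂ h₃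
  | epsilon m n h => exact sat_epsilon U v h
  | matrixExtensionality m n => exact sat_matrixExtensionality U v m n
  | extensionality => exact sat_extensionality U v
  | emptySet => exact sat_emptySet U v
  | separation Φ => exact sat_separation U v Φ
  | pairing => exact sat_pairing U v
  | union => exact sat_union U v
  | powerSet => exact sat_powerSet U v
  | infinity => exact sat_infinity U v
  | replacement Φ => exact sat_replacement U v Φ
  | setOfSetMatrices m n => exact sat_setOfSetMatrices U v m n
  | regularity => exact sat_regularity U v

end Axioms
end SMT
end SetMatrixTheory

theorem mainTheorem1 :
    SetMatrixTheory.Consistent SetMatrixTheory.ZF.theory →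
      SetMatrixTheory.Consistent SetMatrixTheory.SMT.theory := by
  intro h
  obtain ⟨M, E, e, hM⟩ := SetMatrixTheory.ZF.exists_model h
  let U : SetMatrixTheory.ZF.Model := ⟨M, E, e, fun φ hφ => hM φ (.ax hφ)⟩
  refine SetMatrixTheory.consistent_of_model (SetMatrixTheory.SMT.interp U)
    (fun φ hφ v _ => SetMatrixTheory.SMT.sat_of_isAxiom U v hφ) (fun _ => U.empty) ?_
  rintro ⟨_ | _, i⟩
  · exact ⟨U.empty, U.code_empty⟩
  · trivial
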